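/- Let $I=[0,1]$, let $g:\mathbb R\to[0,\infty)$ be a continuous, even probability density that is monotonically decreasing (not necessarily strictly) on $(0,\infty)$, and let $W:I^2\to\mathbb R$ be symmetric and square-integrable. Let $\mathcal W[f](x)=\int_I W(x,y)f(y)\,dy$ be the kernel operator on the complex space $L^2(I)$. On the complex space $L^2(\mathbb R\times I,\ g(\omega)\,d\omega\,dx)$ let $$\mathcal P[z](\omega,x)=\int_I\int_{\mathbb R}W(x,y)\,z(\lambda,y)\,g(\lambda)\,d\lambda\,dy,$$ and for $K\in\mathbb R$ let $T[z]=i\omega z+\tfrac K2\,\mathcal P[z]$, with domain the set of all $z$ in this space for which $\omega z$ is also in it. ($T$ governs the first Fourier mode in the linearization of the mean field Kuramoto equation on the graphon $W$ about the incoherent state.) If $\mathcal W$ has positive eigenvalues, then it has a largest one, $\zeta_{\max}(\mathcal W)$; if it has negative eigenvalues, then it has a smallest one, $\zeta_{\min}(\mathcal W)$. Put $$K_c^+=\frac{2}{\pi g(0)\,\zeta_{\max}(\mathcal W)},\qquad K_c^-=\frac{2}{\pi g(0)\,\zeta_{\min}(\mathcal W)},$$ where $K_c^+:=+\infty$ if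 $\mathcal W$ has no positive eigenvalue and $K_c^-:=-\infty$ if $\mathcal W$ has no negative eigenvalue. Then for every $K\in\mathbb R$ the operator $T$ is closed, its residual spectrum is empty, and its continuous spectrum (the points $\lambda$ of the spectrum for which $T-\lambda$ is injective with dense range) is $\sigma_c(T)=i\,\mathrm{supp}(g)$. Moreover: 1. if $K_c^-\le K\le K_c^+$, then the spectrum of $T$ is the union of the continuous spectrum $i\,\mathrm{supp}(g)$ and the set of eigenvalues of $T$, and every eigenvalue of $T$ (there may be none) is a negative real number; 2. otherwise, $T$ has at least one positive real eigenvalue. -/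

import Mathlib

open MeasureTheory Set
open scoped ENNReal unitInterval

noncomputable section

namespace KMGraph

/-! ### Spectra of (unbounded) linear operators on a complex normed space -/

section Spectrum

variable {E : Type*} [NormedAddCommGroup E] [NormedSpace ℂ E]

/-- The operator `A - z`, with the same domain as `A`. -/
def shift (A : E →ₗ.[ℂ] E) (z : ℂ) : A.domain →ₗ[ℂ] E :=
  A.toFun - z • A.domain.subtype

/-- The resolvent set: `A - z` is a bijection from the domain onto the whole space,
with bounded inverse. -/
def resolventSet (A : E →ₗ.[ℂ] E) : Set ℂ :=
  {z | Function.Bijective (shift A z) ∧ ∃ C : ℝ, ∀ v : A.domain, ‖(v : E)‖ ≤ C * ‖shift A z v‖}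

/-- The spectrum: the complement of the resolvent set. -/
def fullSpectrum (A : E →ₗ.[ℂ] E) : Set ℂ := (resolventSet A)ᶜ

/-- The point spectrum: the set of eigenvalues. -/
def pointSpectrum (A : E →ₗ.[ℂ] E) : Set ℂ :=
  {z | ∃ v : A.domain, (v : E) ≠ 0 ∧ A v = z • (v : E)}

/-- The continuous spectrum: points of the spectrum at which `A - z` is injective with dense
range. -/
def continuousSpectrum (A : E →ₗ.[ℂ] E) : Set ℂ :=
  {z | z ∈ fullSpectrum A ∧ Function.Injective (shift A z) ∧ DenseRange (shift A z)}

/-- The residual spectrum: `A - z` is injective and its range is not dense. -/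
def residualSpectrum (A : E →ₗ.[ℂ] E) : Set ℂ :=
  {z | Function.Injective (shift A z) ∧ ¬ DenseRange (shift A z)}

end Spectrum

/-! ### Integral operators with square-integrable kernels -/

section Kernel

variable {α : Type*} [MeasurableSpace α] {μ : Measure α} [SFinite μ]

theorem kernel_section_memLp {k : α → α → ℂ}
    (hk : MemLp (Function.uncurry k) 2 (μ.prod μ)) : ∀ᵐ x ∂μ, MemLp (k x) 2 μ := by
  have h1 := (memLp_two_iff_integrable_sq_norm hk.1).1 hk
  filter_upwards [h1.prod_right_ae, hk.1.prodMk_left] with x hx hx'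
  exact (memLp_two_iff_integrable_sq_norm hx').2 hx

theorem kernel_integrable {k : α → α → ℂ} (hk : MemLp (Function.uncurry k) 2 (μ.prod μ))
    (f : Lp ℂ 2 μ) : ∀ᵐ x ∂μ, Integrable (fun y => k x y * f y) μ := by
  filter_upwards [kernel_section_memLp hk] with x hx
  exact MemLp.integrable_mul hx (Lp.memLp f)

theorem kernel_memLp {k : α → α → ℂ} (hk : MemLp (Function.uncurry k) 2 (μ.prod μ))
    (f : Lp ℂ 2 μ) : MemLp (fun x => ∫ y, k x y * f y ∂μ) 2 μ := by
  have hf := Lp.memLp f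
  have hm : AEStronglyMeasurable (fun x => ∫ y, k x y * f y ∂μ) μ :=
    AEStronglyMeasurable.integral_prod_right' (f := fun q : α × α => k q.1 q.2 * f q.2)
      (hk.1.mul hf.1.comp_snd)
  refine ⟨hm, ?_⟩
  have hk2 : ∫⁻ q, ‖Function.uncurry k q‖ₑ ^ (2 : ℝ) ∂(μ.prod μ) < ⊤ := by
    simpa using lintegral_rpow_enorm_lt_top_of_eLpNorm_lt_top (by simp) (by simp) hk.2
  have hf2 : ∫⁻ y, ‖f y‖ₑ ^ (2 : ℝ) ∂μ < ⊤ := by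
    simpa using lintegral_rpow_enorm_lt_top_of_eLpNorm_lt_top (by simp) (by simp) hf.2
  rw [eLpNorm_lt_top_iff_lintegral_rpow_enorm_lt_top (by simp) (by simp)]
  simp only [ENNReal.toReal_ofNat]
  rw [lintegral_prod _ (hk.1.enorm.pow_const _)] at hk2
  calc ∫⁻ x, ‖∫ y, k x y * f y ∂μ‖ₑ ^ (2 : ℝ) ∂μ
      ≤ ∫⁻ x, (∫⁻ y, ‖k x y‖ₑ ^ (2 : ℝ) ∂μ) * (∫⁻ y, ‖f y‖ₑ ^ (2 : ℝ) ∂μ) ∂μ := by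
        refine lintegral_mono_ae ?_
        filter_upwards [kernel_section_memLp hk] with x hx
        have h1 : ‖∫ y, k x y * f y ∂μ‖ₑ ≤
            (∫⁻ y, ‖k x y‖ₑ ^ (2 : ℝ) ∂μ) ^ (1 / (2 : ℝ)) *
              (∫⁻ y, ‖f y‖ₑ ^ (2 : ℝ) ∂μ) ^ (1 / (2 : ℝ)) := by
          refine (enorm_integral_le_lintegral_enorm _).trans ?_
          simp only [enorm_mul]
          exact ENNReal.lintegral_mul_le_Lp_mul_Lq μ Real.HolderConjugate.two_two
            hx.1.enorm hf.1.enorm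
        refine (ENNReal.rpow_le_rpow h1 (by norm_num)).trans ?_
        rw [ENNReal.mul_rpow_of_nonneg _ _ (by norm_num), ← ENNReal.rpow_mul, ← ENNReal.rpow_mul]
        norm_num
    _ = (∫⁻ x, (∫⁻ y, ‖k x y‖ₑ ^ (2 : ℝ) ∂μ) ∂μ) * (∫⁻ y, ‖f y‖ₑ ^ (2 : ℝ) ∂μ) :=
        lintegral_mul_const' _ _ hf2.ne
    _ < ⊤ := ENNReal.mul_lt_top hk2 hf2

/-- The integral operator `f ↦ ∫ k(·, y) f(y) dμ(y)` on `L²(μ)`, for `k ∈ L²(μ × μ)`. -/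
def kernelOp (k : α → α → ℂ) (hk : MemLp (Function.uncurry k) 2 (μ.prod μ)) :
    Lp ℂ 2 μ →ₗ[ℂ] Lp ℂ 2 μ where
  toFun f := (kernel_memLp hk f).toLp
  map_add' f h := by
    rw [← MemLp.toLp_add]
    refine MemLp.toLp_congr _ _ ?_
    filter_upwards [kernel_integrable hk f, kernel_integrable hk h] with x h1 h2
    simp only [Pi.add_apply]
    rw [← integral_add h1 h2]
    refine integral_congr_ae ?_
    filter_upwards [Lp.coeFn_add f h] with y hy
    rw [hy, Pi.add_apply, mul_add]
  map_smul' c f := by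
    rw [RingHom.id_apply, ← MemLp.toLp_const_smul]
    refine MemLp.toLp_congr _ _ (Filter.Eventually.of_forall fun x => ?_)
    simp only [Pi.smul_apply]
    rw [← integral_smul]
    refine integral_congr_ae ?_
    filter_upwards [Lp.coeFn_smul c f] with y hy
    rw [hy, Pi.smul_apply, smul_eq_mul, smul_eq_mul, mul_left_comm]

end Kernel

/-! ### Graphons and frequency densities -/

/-- A graphon: a symmetric, square-integrable real function on the unit square. -/
structure Graphon where
  kernel : I → I → ℝ
  symm : ∀ x y, kernel x y = kernel y x
  memLp : MemLp (Function.uncurry kernel) 2 (volume.prod volume)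

/-- A continuous even probability density on `ℝ` that is monotonically decreasing (not
necessarily strictly) on the positive half-line. -/
structure FreqDensity where
  dens : ℝ → ℝ
  continuous : Continuous dens
  nonneg : ∀ ω, 0 ≤ dens ω
  integral_eq_one : ∫ ω, dens ω = 1
  even : ∀ ω, dens (-ω) = dens ω
  antitoneOn : AntitoneOn dens (Ioi 0)

/-- The probability measure `g(ω) dω` on `ℝ`. -/
def FreqDensity.measure (g : FreqDensity) : Measure ℝ :=
  volume.withDensity fun ω => ENNReal.ofReal (g.dens ω)

instance FreqDensity.isProbabilityMeasure (g : FreqDensity) : IsProbabilityMeasure g.measure := by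
  have hi : Integrable g.dens := by
    by_contra h
    exact zero_ne_one ((integral_undef h).symm.trans g.integral_eq_one)
  constructor
  rw [FreqDensity.measure, withDensity_apply _ MeasurableSet.univ, Measure.restrict_univ,
    ← ofReal_integral_eq_lintegral_ofReal hi (Filter.Eventually.of_forall g.nonneg),
    g.integral_eq_one, ENNReal.ofReal_one]

/-- The measure `g(ω) dω dx` on `X = ℝ × I`. -/
abbrev FreqDensity.measureX (g : FreqDensity) : Measure (ℝ × I) := g.measure.prod volume

/-- The weighted Lebesgue space `L²(X, g dω dx)` of complex functions, `X = ℝ × I`. -/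
abbrev L2X (g : FreqDensity) : Type := Lp ℂ 2 g.measureX

theorem Graphon.memLp_complex (W : Graphon) :
    MemLp (Function.uncurry fun x y => (W.kernel x y : ℂ)) 2
      ((volume : Measure I).prod (volume : Measure I)) :=
  W.memLp.ofReal

theorem Graphon.memLp_X (W : Graphon) (g : FreqDensity) :
    MemLp (Function.uncurry fun p q : ℝ × I => (W.kernel p.2 q.2 : ℂ)) 2
      (g.measureX.prod g.measureX) := by
  have hs : MeasurePreserving (Prod.snd : ℝ × I → I) g.measureX volume := measurePreserving_snd
  exact W.memLp_complex.comp_measurePreserving (hs.prod hs)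

/-! ### The operators -/

/-- The kernel operator `𝒲[f](x) = ∫_I W(x, y) f(y) dy` on `L²(I)`. -/
def Graphon.op (W : Graphon) : Lp ℂ 2 (volume : Measure I) →ₗ[ℂ] Lp ℂ 2 (volume : Measure I) :=
  kernelOp (fun x y => (W.kernel x y : ℂ)) W.memLp_complex

/-- The operator `𝒫[z](ω, x) = ∫_I ∫_ℝ W(x, y) z(λ, y) g(λ) dλ dy` on `L²(X, g dω dx)`. -/
def opP (g : FreqDensity) (W : Graphon) : L2X g →ₗ[ℂ] L2X g :=
  kernelOp (fun p q => (W.kernel p.2 q.2 : ℂ)) (W.memLp_X g)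

/-- The domain of multiplication by `iω`: all `z ∈ L²(X, g dω dx)` with
`iω z ∈ L²(X, g dω dx)`. -/
def mulDomain (g : FreqDensity) : Submodule ℂ (L2X g) where
  carrier := {z | MemLp (fun p => Complex.I * (p.1 : ℂ) * z p) 2 g.measureX}
  add_mem' := by
    intro a b ha hb
    refine (MemLp.add ha hb).ae_eq ?_
    filter_upwards [Lp.coeFn_add a b] with p hp
    rw [hp, Pi.add_apply, Pi.add_apply, mul_add]
  zero_mem' := by
    refine (MemLp.zero (ε := ℂ)).ae_eq ?_
    filter_upwards [Lp.coeFn_zero ℂ 2 g.measureX] with p hp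
    rw [hp, Pi.zero_apply, mul_zero]
  smul_mem' := by
    intro c a ha
    refine (MemLp.const_smul ha c).ae_eq ?_
    filter_upwards [Lp.coeFn_smul c a] with p hp
    rw [hp, Pi.smul_apply, Pi.smul_apply, smul_eq_mul, smul_eq_mul, mul_left_comm]

theorem memLp_of_mem_mulDomain {g : FreqDensity} {z : L2X g} (hz : z ∈ mulDomain g) :
    MemLp (fun p => Complex.I * (p.1 : ℂ) * z p) 2 g.measureX := hz

/-- Multiplication by `iω` on its maximal domain in `L²(X, g dω dx)`. -/
def mulOp (g : FreqDensity) : L2X g →ₗ.[ℂ] L2X g where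
  domain := mulDomain g
  toFun :=
    { toFun := fun z => (memLp_of_mem_mulDomain z.2).toLp
      map_add' := by
        intro a b
        rw [← MemLp.toLp_add]
        refine MemLp.toLp_congr _ _ ?_
        filter_upwards [Lp.coeFn_add (a : L2X g) (b : L2X g)] with p hp
        rw [Submodule.coe_add, hp, Pi.add_apply, Pi.add_apply, mul_add]
      map_smul' := by
        intro c a
        rw [RingHom.id_apply, ← MemLp.toLp_const_smul]
        refine MemLp.toLp_congr _ _ ?_
        filter_upwards [Lp.coeFn_smul c (a : L2X g)] with p hp
        rw [Submodule.coe_smul, hp, Pi.smul_apply, Pi.smul_apply, smul_eq_mul, smul_eq_mul,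
          mul_left_comm] }

/-- The linearization of the first Fourier mode, `T[z] = iω z + (K/2) 𝒫[z]`, on the maximal domain
of the multiplication by `iω`. -/
def opT (g : FreqDensity) (W : Graphon) (K : ℝ) : L2X g →ₗ.[ℂ] L2X g where
  domain := (mulOp g).domain
  toFun := (mulOp g).toFun + ((K : ℂ) / 2) • (opP g W ∘ₗ (mulOp g).domain.subtype)

/-! ### Extreme eigenvalues of `𝒲` and the transition points -/

/-- The positive eigenvalues of `𝒲`. -/
def Graphon.posEigs (W : Graphon) : Set ℝ :=
  {ζ | 0 < ζ ∧ Module.End.HasEigenvalue W.op (ζ : ℂ)}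

/-- The negative eigenvalues of `𝒲`. -/
def Graphon.negEigs (W : Graphon) : Set ℝ :=
  {ζ | ζ < 0 ∧ Module.End.HasEigenvalue W.op (ζ : ℂ)}

/-- The largest positive eigenvalue of `𝒲` (meaningful if there is a positive eigenvalue). -/
def Graphon.zetaMax (W : Graphon) : ℝ := sSup W.posEigs

/-- The smallest negative eigenvalue of `𝒲` (meaningful if there is a negative eigenvalue). -/
def Graphon.zetaMin (W : Graphon) : ℝ := sInf W.negEigs

open Classical in
/-- `K_c⁺ = 2 / (π g(0) ζ_max(𝒲))`, which is `+∞` if `𝒲` has no positive eigenvalue. -/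
def KcPlus (g : FreqDensity) (W : Graphon) : EReal :=
  if W.posEigs.Nonempty then ((2 / (Real.pi * g.dens 0 * W.zetaMax) : ℝ) : EReal) else ⊤

open Classical in
/-- `K_c⁻ = 2 / (π g(0) ζ_min(𝒲))`, which is `-∞` if `𝒲` has no negative eigenvalue. -/
def KcMinus (g : FreqDensity) (W : Graphon) : EReal :=
  if W.negEigs.Nonempty then ((2 / (Real.pi * g.dens 0 * W.zetaMin) : ℝ) : EReal) else ⊥

end KMGraph

end

open KMGraph

noncomputable section

namespace KMGraph

/-! ### Kernel operators as bounded Hilbert–Schmidt operators -/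

section HilbertSchmidt

open scoped InnerProductSpace ComplexConjugate

variable {α : Type*} [MeasurableSpace α] {μ : Measure α}

/-! If `(T - z) v = 0`, then `v = (K/2) f(x) / (z - iω)` with `f = 𝒫 v`, a function of `x` alone.
Averaging over `ω` gives `f = (K/2) D(z) 𝒲 f`, where `D(z) = ∫ (z - iω)⁻¹ g(ω) dω` is `transform`.
So an eigenvalue `z` satisfies `(K/2) D(z) ζ = 1` for some eigenvalue `ζ` of `𝒲`, and conversely
when `Re z ≠ 0`. Since `𝒲` is symmetric, `ζ` is real, hence so is `D(z)`.

On the imaginary axis `Re D = 0`, so there are no eigenvalues there. Off the axis, evenness and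
monotonicity of `g` force `z` to be real once `D(z)` is (`im_eq_zero_of_transform_im_eq_zero`). For
`x > 0`, `D(x) = ∫ g(xt)/(1+t²) dt` lies strictly below `π g(0)`, and takes every value in `(0, π
g(0))`. Hence a positive eigenvalue exists exactly when `Kζ > 2/(π g(0))` for some `ζ`; the extreme
`ζ` decide this.

The rest of the spectrum: `𝒫` is compact, so off `i supp g` the Fredholm alternative leaves only
eigenvalues and resolvent points. On `i supp g`, concentrated indicators violate every resolvent
bound. On the whole axis the range of `T - z` is dense, because a vector orthogonal to it would be
an eigenvector at `z` for coupling `-K`. -/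

theorem memLp_two_tensor [SFinite μ] {h f : α → ℂ} (hh : MemLp h 2 μ) (hf : MemLp f 2 μ) :
    MemLp (fun p : α × α => h p.1 * f p.2) 2 (μ.prod μ) := by
  have hm : AEStronglyMeasurable (fun p : α × α => h p.1 * f p.2) (μ.prod μ) :=
    hh.1.comp_fst.mul hf.1.comp_snd
  rw [memLp_two_iff_integrable_sq_norm hm]
  have h1 := (memLp_two_iff_integrable_sq_norm hh.1).1 hh
  have h2 := (memLp_two_iff_integrable_sq_norm hf.1).1 hf
  simpa [mul_pow] using h1.mul_prod h2

theorem norm_sq_eq_integral (f : Lp ℂ 2 μ) : ‖f‖ ^ 2 = ∫ x, ‖f x‖ ^ 2 ∂μ := by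
  have h := inner_self_eq_norm_sq_to_K (𝕜 := ℂ) f
  rw [L2.inner_def] at h
  simp only [inner_self_eq_norm_sq_to_K] at h
  have h2 : (((∫ x, ‖f x‖ ^ 2 ∂μ : ℝ)) : ℂ) = ((‖f‖ ^ 2 : ℝ) : ℂ) := by
    rw [← integral_complex_ofReal]
    simpa using h
  exact_mod_cast h2.symm

theorem norm_toLp_tensor [SFinite μ] (h f : Lp ℂ 2 μ) :
    ‖(memLp_two_tensor (Lp.memLp h) (Lp.memLp f)).toLp‖ = ‖h‖ * ‖f‖ := by
  rw [← sq_eq_sq₀ (norm_nonneg _) (by positivity), mul_pow, norm_sq_eq_integral,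
    norm_sq_eq_integral, norm_sq_eq_integral, ← integral_prod_mul]
  refine integral_congr_ae ?_
  filter_upwards [(memLp_two_tensor (Lp.memLp h) (Lp.memLp f)).coeFn_toLp] with p hp
  rw [hp, norm_mul, mul_pow]

theorem memLp_two_conj {f : α → ℂ} (hf : MemLp f 2 μ) : MemLp (fun x => conj (f x)) 2 μ := by
  simpa using! hf.star

theorem memLp_uncurry (κ : Lp ℂ 2 (μ.prod μ)) :
    MemLp (Function.uncurry fun x y => κ (x, y)) 2 (μ.prod μ) := Lp.memLp κ

variable [SFinite μ]

theorem integrable_kernel_mul_tensor {k : α → α → ℂ}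
    (hk : MemLp (Function.uncurry k) 2 (μ.prod μ)) {h f : α → ℂ} (hh : MemLp h 2 μ)
    (hf : MemLp f 2 μ) :
    Integrable (fun p : α × α => conj (h p.1) * k p.1 p.2 * f p.2) (μ.prod μ) := by
  refine (MemLp.integrable_mul hk (memLp_two_tensor (memLp_two_conj hh) hf)).congr
    (Filter.Eventually.of_forall fun p => ?_)
  simp only [Pi.mul_apply, Function.uncurry]
  ring

theorem kernelOp_coeFn {k : α → α → ℂ} (hk : MemLp (Function.uncurry k) 2 (μ.prod μ))
    (f : Lp ℂ 2 μ) : kernelOp k hk f =ᵐ[μ] fun x => ∫ y, k x y * f y ∂μ :=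
  (kernel_memLp hk f).coeFn_toLp

theorem inner_kernelOp {k : α → α → ℂ} (hk : MemLp (Function.uncurry k) 2 (μ.prod μ))
    (h f : Lp ℂ 2 μ) :
    ⟪h, kernelOp k hk f⟫_ℂ = ∫ p : α × α, conj (h p.1) * k p.1 p.2 * f p.2 ∂(μ.prod μ) := by
  rw [integral_prod _ (integrable_kernel_mul_tensor hk (Lp.memLp h) (Lp.memLp f)), L2.inner_def]
  refine integral_congr_ae ?_
  filter_upwards [kernelOp_coeFn hk f] with x hx
  rw [hx, RCLike.inner_apply, mul_comm, ← integral_const_mul]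
  simp only [mul_assoc]

/-- The kernel operator of a Hermitian kernel is symmetric. -/
theorem kernelOp_inner_comm {k : α → α → ℂ} (hk : MemLp (Function.uncurry k) 2 (μ.prod μ))
    (hs : ∀ x y, conj (k x y) = k y x) (h f : Lp ℂ 2 μ) :
    ⟪h, kernelOp k hk f⟫_ℂ = ⟪kernelOp k hk h, f⟫_ℂ := by
  rw [← inner_conj_symm (kernelOp k hk h) f, inner_kernelOp, inner_kernelOp, ← integral_conj,
    ← integral_prod_swap]
  refine integral_congr_ae (Filter.Eventually.of_forall fun p => ?_)
  simp [hs]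
  ring

/-- Duality: for `g` the image of `f`, `‖g‖²` is the inner product of `κ` with the tensor of `g` and
`conj f`, so Cauchy–Schwarz on the product space bounds it by `‖κ‖ ‖g‖ ‖f‖`. -/
theorem norm_kernelOp_le (κ : Lp ℂ 2 (μ.prod μ)) (f : Lp ℂ 2 μ) :
    ‖kernelOp (fun x y => κ (x, y)) (memLp_uncurry κ) f‖ ≤ ‖κ‖ * ‖f‖ := by
  set g := kernelOp (fun x y => κ (x, y)) (memLp_uncurry κ) f with hg
  have hc := memLp_two_conj (Lp.memLp f)
  set w := (memLp_two_tensor (Lp.memLp g) (Lp.memLp hc.toLp)).toLp with hw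
  have h1 : ⟪g, g⟫_ℂ = ⟪w, κ⟫_ℂ := by
    nth_rw 2 [hg]
    rw [inner_kernelOp, L2.inner_def]
    refine integral_congr_ae ?_
    filter_upwards [(memLp_two_tensor (Lp.memLp g) (Lp.memLp hc.toLp)).coeFn_toLp,
      Measure.quasiMeasurePreserving_snd.ae hc.coeFn_toLp] with p hp hq
    rw [hw, hp, hq, RCLike.inner_apply]
    simp only [map_mul, Complex.conj_conj]
    ring
  have h2 : ‖hc.toLp‖ = ‖f‖ := by
    rw [Lp.norm_toLp, Lp.norm_def]
    congr 1
    exact eLpNorm_congr_norm_ae (Filter.Eventually.of_forall fun x => by simp)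
  have h3 : ‖g‖ ^ 2 ≤ ‖g‖ * (‖κ‖ * ‖f‖) := by
    calc ‖g‖ ^ 2 = ‖⟪g, g⟫_ℂ‖ := by rw [inner_self_eq_norm_sq_to_K]; simp
      _ ≤ ‖w‖ * ‖κ‖ := by rw [h1]; exact norm_inner_le_norm _ _
      _ = ‖g‖ * (‖κ‖ * ‖f‖) := by rw [hw, norm_toLp_tensor, h2]; ring
  rcases (norm_nonneg g).eq_or_lt with h0 | h0
  · rw [← h0]; positivity
  · rw [sq] at h3; exact le_of_mul_le_mul_left h3 h0

/-- The map sending a square-integrable kernel to its Hilbert–Schmidt operator. -/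
def hilbertSchmidt : Lp ℂ 2 (μ.prod μ) →L[ℂ] (Lp ℂ 2 μ →L[ℂ] Lp ℂ 2 μ) :=
  LinearMap.mkContinuous
    { toFun := fun κ => LinearMap.mkContinuous
        (kernelOp (fun x y => κ (x, y)) (memLp_uncurry κ)) ‖κ‖ (norm_kernelOp_le κ)
      map_add' := by
        intro κ κ'
        ext1 f
        refine ext_inner_left ℂ fun h => ?_
        simp only [LinearMap.mkContinuous_apply, add_apply, inner_add_right,
          inner_kernelOp]
        rw [← integral_add (integrable_kernel_mul_tensor (memLp_uncurry κ)
          (Lp.memLp h) (Lp.memLp f)) (integrable_kernel_mul_tensor (memLp_uncurry κ')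
          (Lp.memLp h) (Lp.memLp f))]
        refine integral_congr_ae ?_
        filter_upwards [Lp.coeFn_add κ κ'] with p hp
        simp only [Prod.mk.eta, hp, Pi.add_apply]
        ring
      map_smul' := by
        intro c κ
        ext1 f
        refine ext_inner_left ℂ fun h => ?_
        simp only [LinearMap.mkContinuous_apply, smul_apply, inner_smul_right,
          inner_kernelOp, RingHom.id_apply]
        rw [← integral_const_mul]
        refine integral_congr_ae ?_
        filter_upwards [Lp.coeFn_smul c κ] with p hp
        simp only [Prod.mk.eta, hp, Pi.smul_apply, smul_eq_mul]
        ring } 1 fun κ => by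
    rw [one_mul]
    exact LinearMap.mkContinuous_norm_le _ (norm_nonneg κ) (norm_kernelOp_le κ)

theorem hilbertSchmidt_apply (κ : Lp ℂ 2 (μ.prod μ)) (f : Lp ℂ 2 μ) :
    hilbertSchmidt κ f = kernelOp (fun x y => κ (x, y)) (memLp_uncurry κ) f := rfl

theorem hilbertSchmidt_toLp {k : α → α → ℂ} (hk : MemLp (Function.uncurry k) 2 (μ.prod μ))
    (f : Lp ℂ 2 μ) : hilbertSchmidt hk.toLp f = kernelOp k hk f := by
  refine ext_inner_left ℂ fun h => ?_
  rw [hilbertSchmidt_apply, inner_kernelOp, inner_kernelOp]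
  refine integral_congr_ae ?_
  filter_upwards [hk.coeFn_toLp] with p hp
  simp only [Prod.mk.eta, hp, Function.uncurry]

theorem isCompactOperator_rankOne {E : Type*} [NormedAddCommGroup E] [NormedSpace ℂ E]
    (φ : E →L[ℂ] ℂ) (v : E) : IsCompactOperator (φ.smulRight v : E →L[ℂ] E) := by
  exact (isCompactOperator_of_locallyCompactSpace_dom φ).clm_comp
    (ContinuousLinearMap.toSpanSingleton ℂ v)

end HilbertSchmidt

/-! ### Compactness of Hilbert–Schmidt operators -/

section FiniteMeasure

open scoped InnerProductSpace ComplexConjugate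

variable {α : Type*} [MeasurableSpace α] {μ : Measure α} [IsFiniteMeasure μ]

theorem hilbertSchmidt_indicator {s t : Set α} (hs : MeasurableSet s) (ht : MeasurableSet t) :
    hilbertSchmidt (indicatorConstLp 2 (μ := μ.prod μ) (hs.prod ht) (measure_ne_top _ _) (1 : ℂ)) =
      (innerSL ℂ (indicatorConstLp 2 (μ := μ) ht (measure_ne_top _ _) (1 : ℂ))).smulRight
        (indicatorConstLp 2 (μ := μ) hs (measure_ne_top _ _) (1 : ℂ)) := by
  ext1 f
  refine ext_inner_left ℂ fun h => ?_
  rw [hilbertSchmidt_apply, inner_kernelOp, ContinuousLinearMap.smulRight_apply, inner_smul_right,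
    innerSL_apply_apply, L2.inner_indicatorConstLp_one, ← inner_conj_symm h,
    L2.inner_indicatorConstLp_one, ← integral_conj, mul_comm, ← setIntegral_prod_mul,
    ← integral_indicator (hs.prod ht)]
  refine integral_congr_ae ?_
  filter_upwards [indicatorConstLp_coeFn (p := 2) (μ := μ.prod μ) (hs := hs.prod ht)
    (hμs := measure_ne_top _ _) (c := (1 : ℂ))] with p hp
  simp only [Prod.mk.eta, hp]
  by_cases h : p ∈ s ×ˢ t <;> simp [h]

/-- Rectangles form a π-system generating the product σ-algebra, so vanishing of the integral
propagates from them to every measurable set. -/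
theorem ae_eq_zero_of_forall_setIntegral_rectangle {f : α × α → ℂ} (hf : Integrable f (μ.prod μ))
    (h : ∀ s t, MeasurableSet s → MeasurableSet t → ∫ p in s ×ˢ t, f p ∂(μ.prod μ) = 0) :
    f =ᵐ[μ.prod μ] 0 := by
  refine hf.ae_eq_zero_of_forall_setIntegral_eq_zero fun A hA _ => ?_
  induction A, hA using MeasurableSpace.induction_on_inter generateFrom_prod.symm
    isPiSystem_prod with
  | empty => simp
  | basic A hA =>
    obtain ⟨s, hs, t, ht, rfl⟩ := hA
    exact h s t hs ht
  | compl A hA ih =>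
    rw [setIntegral_compl hA hf, ih (measure_lt_top _ _), ← setIntegral_univ, ← univ_prod_univ,
      h _ _ .univ .univ, sub_zero]
  | iUnion A hd hA ih =>
    rw [integral_iUnion hA hd hf.integrableOn]
    simp [ih _ (measure_lt_top _ _)]

/-- The kernels with compact operator form a closed subspace. It contains the indicators of
rectangles, whose operators have rank at most one, and nothing nonzero is orthogonal to all of
those. -/
theorem isCompactOperator_hilbertSchmidt (κ : Lp ℂ 2 (μ.prod μ)) :
    IsCompactOperator (hilbertSchmidt κ) := by
  let S : Submodule ℂ (Lp ℂ 2 (μ.prod μ)) :=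
    (compactOperator (RingHom.id ℂ) (Lp ℂ 2 μ) (Lp ℂ 2 μ)).comap
      (hilbertSchmidt (μ := μ)).toLinearMap
  have hS : IsClosed (S : Set (Lp ℂ 2 (μ.prod μ))) :=
    isClosed_setOfPred_isCompactOperator.preimage (hilbertSchmidt (μ := μ)).continuous
  have hT : S = ⊤ := by
    rw [← hS.submodule_topologicalClosure_eq, Submodule.topologicalClosure_eq_top_iff,
      Submodule.eq_bot_iff]
    intro f hf
    have hi : Integrable f (μ.prod μ) := (Lp.memLp f).integrable (by norm_num)
    refine Lp.eq_zero_iff_ae_eq_zero.2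
      (ae_eq_zero_of_forall_setIntegral_rectangle hi fun s t hs ht => ?_)
    rw [← L2.inner_indicatorConstLp_one (𝕜 := ℂ) (hs.prod ht) (measure_ne_top _ _) f]
    refine (Submodule.mem_orthogonal S f).1 hf _ ?_
    change IsCompactOperator (hilbertSchmidt (μ := μ) _)
    rw [hilbertSchmidt_indicator hs ht]
    exact isCompactOperator_rankOne _ _
  have : κ ∈ S := hT ▸ Submodule.mem_top
  exact this

/-- A kernel operator as a continuous linear map. -/
def kernelCLM (k : α → α → ℂ) (hk : MemLp (Function.uncurry k) 2 (μ.prod μ)) :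
    Lp ℂ 2 μ →L[ℂ] Lp ℂ 2 μ :=
  hilbertSchmidt hk.toLp

theorem kernelCLM_apply {k : α → α → ℂ} (hk : MemLp (Function.uncurry k) 2 (μ.prod μ))
    (f : Lp ℂ 2 μ) : kernelCLM k hk f = kernelOp k hk f :=
  hilbertSchmidt_toLp hk f

theorem isCompactOperator_kernelCLM {k : α → α → ℂ}
    (hk : MemLp (Function.uncurry k) 2 (μ.prod μ)) : IsCompactOperator (kernelCLM k hk) :=
  isCompactOperator_hilbertSchmidt _

end FiniteMeasure

/-! ### The density and its transform -/

namespace FreqDensity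

open scoped ComplexConjugate
open Filter Topology

variable (g : FreqDensity)

theorem integrable_dens : Integrable g.dens := by
  by_contra h
  exact zero_ne_one ((integral_undef h).symm.trans g.integral_eq_one)

theorem antitoneOn_Ici : AntitoneOn g.dens (Ici 0) := by
  intro a ha b hb hab
  rcases (mem_Ici.1 ha).eq_or_lt with h | h
  · rcases (mem_Ici.1 hb).eq_or_lt with h' | h'
    · rw [← h, ← h']
    · have ht : Tendsto g.dens (𝓝[>] 0) (𝓝 (g.dens 0)) :=
        g.continuous.continuousAt.tendsto.mono_left nhdsWithin_le_nhds
      rw [← h]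
      refine ge_of_tendsto ht ?_
      filter_upwards [Ioo_mem_nhdsGT h'] with c hc
      exact g.antitoneOn hc.1 h' hc.2.le
  · exact g.antitoneOn h (h.trans_le hab) hab

theorem dens_abs (a : ℝ) : g.dens |a| = g.dens a := by
  rcases abs_choice a with h | h <;> rw [h]
  exact g.even a

theorem dens_le_of_abs_le {a b : ℝ} (h : |a| ≤ |b|) : g.dens b ≤ g.dens a := by
  rw [← g.dens_abs a, ← g.dens_abs b]
  exact g.antitoneOn_Ici (abs_nonneg a) (abs_nonneg b) h

theorem dens_le_dens_zero (a : ℝ) : g.dens a ≤ g.dens 0 :=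
  g.dens_le_of_abs_le (by simp)

theorem not_const : ¬ ∀ t, g.dens t = g.dens 0 := by
  intro h
  have hf : g.dens = fun _ => g.dens 0 := funext h
  have hi := g.integrable_dens
  rw [hf, integrable_const_iff] at hi
  have h1 := g.integral_eq_one
  rcases hi with h0 | h0
  · rw [hf, h0] at h1
    simp at h1
  · have := h0.measure_univ_lt_top
    simp at this

theorem dens_zero_pos : 0 < g.dens 0 := by
  refine (g.nonneg 0).lt_of_ne fun h => g.not_const fun t => ?_
  exact le_antisymm (g.dens_le_dens_zero t) (h ▸ g.nonneg t)

/-- The maximum `g(0)` would recur at every `np`; as `g` decreases in `|t|`, it would then be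
constant, which no probability density on the line is. -/
theorem not_periodic {p : ℝ} (hp : p ≠ 0) : ¬ Function.Periodic g.dens p := by
  intro h
  refine g.not_const fun t => le_antisymm (g.dens_le_dens_zero t) ?_
  obtain ⟨n, hn⟩ := exists_nat_ge (|t| / |p|)
  have h0 : g.dens (n * p) = g.dens 0 := by simpa using h.nat_mul n 0
  rw [← h0]
  refine g.dens_le_of_abs_le ?_
  rw [abs_mul, Nat.abs_cast]
  exact (div_le_iff₀ (abs_pos.2 hp)).1 hn

theorem integral_measure {E : Type*} [NormedAddCommGroup E] [NormedSpace ℝ E] (f : ℝ → E) :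
    ∫ ω, f ω ∂g.measure = ∫ ω, g.dens ω • f ω := by
  rw [measure, integral_withDensity_eq_integral_toReal_smul₀
    g.continuous.measurable.ennreal_ofReal.aemeasurable (by simp)]
  simp [ENNReal.toReal_ofReal (g.nonneg _)]

theorem measure_absolutelyContinuous : g.measure ≪ volume :=
  withDensity_absolutelyContinuous _ _

instance nullSingletonClass_measure : NullSingletonClass g.measure :=
  ⟨fun x => g.measure_absolutelyContinuous (by simp)⟩

theorem ae_mem_tsupport : ∀ᵐ ω ∂g.measure, ω ∈ tsupport g.dens := by
  rw [measure, ae_withDensity_iff g.continuous.measurable.ennreal_ofReal]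
  refine Eventually.of_forall fun ω hω => subset_tsupport _ ?_
  intro h
  simp [h] at hω

theorem measure_pos_of_mem_tsupport {τ : ℝ} (hτ : τ ∈ tsupport g.dens) {U : Set ℝ}
    (hU : IsOpen U) (hτU : τ ∈ U) : 0 < g.measure U := by
  obtain ⟨a, haU, ha⟩ := mem_closure_iff.1 hτ U hU hτU
  have hV : IsOpen (U ∩ Function.support g.dens) :=
    hU.inter (g.continuous.isOpen_support)
  refine pos_iff_ne_zero.2 fun h0 => ?_
  rw [measure, withDensity_apply_eq_zero g.continuous.measurable.ennreal_ofReal] at h0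
  refine (hV.measure_pos volume ⟨a, haU, ha⟩).ne' (measure_mono_null ?_ h0)
  intro b hb
  refine ⟨?_, hb.1⟩
  simp only [mem_ofPred_eq, ne_eq, ENNReal.ofReal_eq_zero, not_le]
  exact (g.nonneg b).lt_of_ne (Ne.symm hb.2)

/-- The Stieltjes-type transform `∫ (z - iω)⁻¹ g(ω) dω`. -/
def transform (z : ℂ) : ℂ := ∫ ω, (z - Complex.I * (ω : ℂ))⁻¹ ∂g.measure

theorem abs_re_le_norm_sub (z : ℂ) (ω : ℝ) : |z.re| ≤ ‖z - Complex.I * (ω : ℂ)‖ := by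
  simpa using Complex.abs_re_le_norm (z - Complex.I * (ω : ℂ))

theorem integrable_inv {z : ℂ} (hz : z.re ≠ 0) :
    Integrable (fun ω : ℝ => (z - Complex.I * (ω : ℂ))⁻¹) g.measure := by
  refine Integrable.of_bound (by fun_prop) (|z.re|⁻¹) (Eventually.of_forall fun ω => ?_)
  rw [norm_inv]
  exact inv_anti₀ (abs_pos.2 hz) (abs_re_le_norm_sub z ω)

/-- The integrand is purely imaginary. No integrability is needed: a divergent integral has the
default value `0`, which also has real part `0`. -/
theorem transform_re_of_re_eq_zero {z : ℂ} (hz : z.re = 0) : (g.transform z).re = 0 := by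
  have h : ∀ ω : ℝ, (z - Complex.I * (ω : ℂ))⁻¹ = -Complex.I * (((z.im - ω)⁻¹ : ℝ) : ℂ) := by
    intro ω
    have : z = Complex.I * (z.im : ℂ) := by
      apply Complex.ext <;> simp [hz]
    rw [this, ← mul_sub, mul_inv, Complex.inv_I]
    simp
  simp only [transform, h]
  rw [integral_const_mul, integral_complex_ofReal]
  simp

theorem transform_re {z : ℂ} (hz : z.re ≠ 0) :
    (g.transform z).re = ∫ ω, z.re / (z.re ^ 2 + (ω - z.im) ^ 2) ∂g.measure := by
  rw [transform, ← Complex.reCLM_apply, ← Complex.reCLM.integral_comp_comm (g.integrable_inv hz)]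
  refine integral_congr_ae (Eventually.of_forall fun ω => ?_)
  simp only [Complex.reCLM_apply, Complex.inv_re, Complex.normSq_apply, Complex.sub_re,
    Complex.sub_im, Complex.mul_re, Complex.mul_im, Complex.I_re, Complex.I_im, Complex.ofReal_re,
    Complex.ofReal_im]
  ring_nf

theorem transform_im {z : ℂ} (hz : z.re ≠ 0) :
    (g.transform z).im = ∫ ω, (ω - z.im) / (z.re ^ 2 + (ω - z.im) ^ 2) ∂g.measure := by
  rw [transform, ← Complex.imCLM_apply, ← Complex.imCLM.integral_comp_comm (g.integrable_inv hz)]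
  refine integral_congr_ae (Eventually.of_forall fun ω => ?_)
  simp only [Complex.imCLM_apply, Complex.inv_im, Complex.normSq_apply, Complex.sub_re,
    Complex.sub_im, Complex.mul_re, Complex.mul_im, Complex.I_re, Complex.I_im, Complex.ofReal_re,
    Complex.ofReal_im]
  ring_nf

theorem abs_div_add_sq_le {x : ℝ} (hx : x ≠ 0) (s : ℝ) : |s / (x ^ 2 + s ^ 2)| ≤ |x|⁻¹ := by
  have h : 0 < x ^ 2 + s ^ 2 := by positivity
  have hx' : 0 < |x| := abs_pos.2 hx
  rw [abs_div, abs_of_pos h, div_le_iff₀ h, inv_mul_eq_div, le_div_iff₀ hx', ← sq_abs x,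
    ← sq_abs s]
  nlinarith [sq_nonneg (|x| - |s|), abs_nonneg s, sq_nonneg (|s|), sq_nonneg (|x|)]

/-- With `s = ω - y`, the imaginary part is the integral of `g(s + y)` against an odd kernel.
Combining it with its reflection `s ↦ -s` gives an integrand of constant sign, since `|y - s| ≤ |s +
y|` exactly when `ys ≥ 0`. A zero integral makes it vanish identically, so `y ≠ 0` would give `g`
the period `2y`. -/
theorem im_eq_zero_of_transform_im_eq_zero {z : ℂ} (hz : z.re ≠ 0)
    (h : (g.transform z).im = 0) : z.im = 0 := by
  by_contra hy
  set x := z.re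
  set y := z.im
  let q : ℝ → ℝ := fun s => s / (x ^ 2 + s ^ 2)
  have hden : ∀ s : ℝ, x ^ 2 + s ^ 2 ≠ 0 := fun s => by positivity
  have hqc : Continuous q := continuous_id.div (by fun_prop) hden
  have hqb : ∀ s, ‖q s‖ ≤ |x|⁻¹ := abs_div_add_sq_le hz
  have hi1 : Integrable fun s => g.dens (s + y) * q s :=
    (g.integrable_dens.comp_add_right y).mul_bdd hqc.aestronglyMeasurable
      (Eventually.of_forall hqb)
  have hi2 : Integrable fun s => g.dens (y - s) * q s :=
    (g.integrable_dens.comp_sub_left y).mul_bdd hqc.aestronglyMeasurable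
      (Eventually.of_forall hqb)
  have e1 : ∫ s, g.dens (s + y) * q s = 0 := by
    rw [g.transform_im hz, g.integral_measure,
      ← integral_add_right_eq_self (fun ω => g.dens ω • ((ω - y) / (x ^ 2 + (ω - y) ^ 2))) y] at h
    simpa [q] using h
  have e2 : ∫ s, g.dens (y - s) * q s = 0 := by
    rw [← integral_neg_eq_self, ← neg_eq_zero, ← integral_neg, ← e1]
    refine integral_congr_ae (Eventually.of_forall fun s => ?_)
    simp only [q, sub_neg_eq_add, add_comm y s, neg_sq]
    ring
  -- The outer factor `y` makes `r` nonnegative whatever the sign of `y`.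
  let r : ℝ → ℝ := fun s => y * ((g.dens (y - s) - g.dens (s + y)) * q s)
  have hrc : Continuous r :=
    continuous_const.mul (((g.continuous.comp (by fun_prop)).sub
      (g.continuous.comp (by fun_prop))).mul hqc)
  have hri : Integrable r := by
    simpa [r, sub_mul] using (hi2.sub hi1).const_mul y
  have hr0 : ∫ s, r s = 0 := by
    simp only [r, sub_mul]
    rw [integral_const_mul, integral_sub hi2 hi1, e1, e2]
    simp
  have hrn : ∀ s, 0 ≤ r s := by
    intro s
    have hp : 0 < x ^ 2 + s ^ 2 := by positivity
    have hr : r s = y * s * (g.dens (y - s) - g.dens (s + y)) / (x ^ 2 + s ^ 2) := by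
      simp only [r, q]; ring
    rw [hr]
    refine div_nonneg ?_ hp.le
    rcases le_total 0 (y * s) with hs | hs
    · refine mul_nonneg hs (sub_nonneg.2 (g.dens_le_of_abs_le (sq_le_sq.1 ?_)))
      nlinarith
    · refine mul_nonneg_of_nonpos_of_nonpos hs (sub_nonpos.2 (g.dens_le_of_abs_le (sq_le_sq.1 ?_)))
      nlinarith
  have hz0 : r = 0 := by
    have := (integral_eq_zero_iff_of_nonneg hrn hri).1 hr0
    exact hrc.ae_eq_iff_eq volume continuous_zero |>.1 this
  refine g.not_periodic (p := 2 * y) (by simpa using hy) fun t => ?_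
  have h1 := congrFun hz0 (t + y)
  simp only [r, q, Pi.zero_apply, mul_eq_zero, hy, false_or, div_eq_zero_iff, hden, or_false,
    sub_eq_zero] at h1
  -- The second case is the zero `s = t + y = 0` of the kernel, where continuity says nothing; there
  -- `t + 2y = -t` and evenness suffices.
  rcases h1 with h1 | h1
  · rw [show y - (t + y) = -t by ring, g.even] at h1
    rw [h1]
    ring_nf
  · rw [show t + 2 * y = -t by linarith, g.even]

/-- The profile `∫ g(xt) / (1 + t²) dt`, which equals the transform at `x > 0` and extends it
continuously to `x = 0`. -/
def profile (x : ℝ) : ℝ := ∫ t, g.dens (x * t) * (1 + t ^ 2)⁻¹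

theorem integrable_profile (x : ℝ) : Integrable fun t : ℝ => g.dens (x * t) * (1 + t ^ 2)⁻¹ := by
  refine integrable_inv_one_add_sq.bdd_mul (c := g.dens 0)
    (g.continuous.comp (by fun_prop)).aestronglyMeasurable (Eventually.of_forall fun t => ?_)
  rw [Real.norm_of_nonneg (g.nonneg _)]
  exact g.dens_le_dens_zero _

theorem profile_zero : g.profile 0 = Real.pi * g.dens 0 := by
  simp only [profile, zero_mul]
  rw [integral_const_mul, integral_univ_inv_one_add_sq, mul_comm]

/-- Equality would force, by continuity, `g(xt) = g(0)` for every `t`. Strictness is what excludes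
positive eigenvalues at the critical coupling itself. -/
theorem profile_lt {x : ℝ} (hx : 0 < x) : g.profile x < Real.pi * g.dens 0 := by
  rw [← g.profile_zero]
  have hle : ∀ t : ℝ, g.dens (x * t) * (1 + t ^ 2)⁻¹ ≤ g.dens (0 * t) * (1 + t ^ 2)⁻¹ := by
    intro t
    rw [zero_mul]
    exact mul_le_mul_of_nonneg_right (g.dens_le_dens_zero _) (by positivity)
  refine (integral_mono (g.integrable_profile x) (g.integrable_profile 0) hle).lt_of_ne fun h => ?_
  have hden : ∀ t : ℝ, (1 + t ^ 2) ≠ 0 := fun t => by positivity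
  have hc : ∀ x : ℝ, Continuous fun t : ℝ => g.dens (x * t) * (1 + t ^ 2)⁻¹ := fun x =>
    (g.continuous.comp (by fun_prop)).mul ((by fun_prop : Continuous fun t : ℝ => 1 + t ^ 2).inv₀
      hden)
  have hae := (integral_eq_iff_of_ae_le (g.integrable_profile x) (g.integrable_profile 0)
    (Eventually.of_forall hle)).1 h
  have heq := ((hc x).ae_eq_iff_eq volume (hc 0)).1 hae
  refine g.not_const fun t => ?_
  have := congrFun heq (t / x)
  simp only [zero_mul, mul_div_cancel₀ t hx.ne'] at this
  exact mul_right_cancel₀ (inv_ne_zero (hden _)) this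

theorem continuous_profile : Continuous g.profile := by
  refine continuous_of_dominated (bound := fun t => g.dens 0 * (1 + t ^ 2)⁻¹)
    (fun x => (g.integrable_profile x).aestronglyMeasurable) (fun x => Eventually.of_forall fun t => ?_)
    (integrable_inv_one_add_sq.const_mul _) (Eventually.of_forall fun t => ?_)
  · rw [Real.norm_of_nonneg (mul_nonneg (g.nonneg _) (by positivity))]
    exact mul_le_mul_of_nonneg_right (g.dens_le_dens_zero _) (by positivity)
  · exact (g.continuous.comp (by fun_prop)).mul continuous_const

theorem profile_le {x : ℝ} (hx : 0 < x) : g.profile x ≤ x⁻¹ := by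
  have h : ∫ t, g.dens (x * t) = x⁻¹ := by
    rw [Measure.integral_comp_mul_left g.dens x, g.integral_eq_one, abs_of_pos (inv_pos.2 hx)]
    simp
  rw [← h]
  refine integral_mono (g.integrable_profile x) (g.integrable_dens.comp_mul_left' hx.ne') fun t => ?_
  refine mul_le_of_le_one_right (g.nonneg _) (inv_le_one_of_one_le₀ ?_)
  nlinarith [sq_nonneg t]

theorem profile_nonneg (x : ℝ) : 0 ≤ g.profile x :=
  integral_nonneg fun t => mul_nonneg (g.nonneg _) (by positivity)

theorem exists_profile_eq {c : ℝ} (hc : 0 < c) (hc' : c < Real.pi * g.dens 0) :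
    ∃ x, 0 < x ∧ g.profile x = c := by
  have hx : (0 : ℝ) < 2 / c := by positivity
  -- At `2/c` the bound `profile x ≤ 1/x` gives `c/2`, so the value `c` is crossed on `[0, 2/c]`.
  have h1 : g.profile (2 / c) ≤ c := by
    refine (g.profile_le hx).trans ?_
    rw [inv_div]
    linarith
  obtain ⟨x, hx, hxc⟩ := intermediate_value_Icc' hx.le g.continuous_profile.continuousOn
    ⟨h1, by rw [g.profile_zero]; exact hc'.le⟩
  refine ⟨x, hx.1.lt_of_ne ?_, hxc⟩
  rintro rfl
  rw [g.profile_zero] at hxc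
  exact hc'.ne' hxc

/-- Substitute `ω = xt` in the real part; the imaginary part cancels because `g` is even. -/
theorem transform_ofReal {x : ℝ} (hx : 0 < x) : g.transform (x : ℂ) = (g.profile x : ℂ) := by
  have hz : (x : ℂ).re ≠ 0 := by simpa using hx.ne'
  apply Complex.ext
  · rw [g.transform_re hz, g.integral_measure, Complex.ofReal_re, Complex.ofReal_re, profile,
      ← mul_inv_cancel_left₀ hx.ne' (∫ ω, g.dens ω • (x / (x ^ 2 + (ω - (x : ℂ).im) ^ 2)))]
    have h := Measure.integral_comp_mul_left
      (fun ω => g.dens ω • (x / (x ^ 2 + (ω - (x : ℂ).im) ^ 2))) x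
    rw [abs_of_pos (inv_pos.2 hx), smul_eq_mul] at h
    rw [← h, ← integral_const_mul]
    refine integral_congr_ae (Eventually.of_forall fun t => ?_)
    simp only [Complex.ofReal_im, sub_zero, smul_eq_mul]
    have : (1 + t ^ 2) ≠ 0 := by positivity
    have : x ^ 2 + (x * t) ^ 2 ≠ 0 := by positivity
    field_simp
  · rw [Complex.ofReal_im, ← Complex.conj_eq_iff_im, transform, ← integral_conj,
      g.integral_measure, g.integral_measure, ← integral_neg_eq_self]
    refine integral_congr_ae (Eventually.of_forall fun t => ?_)
    simp [g.even, sub_eq_add_neg]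

end FreqDensity

open scoped InnerProductSpace ComplexConjugate
open Filter Topology

/-! ### Bounded multiplication operators -/

section Multiplication

variable {α : Type*} [MeasurableSpace α] {μ : Measure α}

theorem memLp_bounded_mul {m : α → ℂ} (hm : AEStronglyMeasurable m μ) {C : ℝ}
    (hC : ∀ᵐ x ∂μ, ‖m x‖ ≤ C) {f : α → ℂ} (hf : MemLp f 2 μ) :
    MemLp (fun x => m x * f x) 2 μ := by
  refine MemLp.of_le_mul (c := C) hf (hm.mul hf.1) ?_
  filter_upwards [hC] with x hx
  rw [norm_mul]
  exact mul_le_mul_of_nonneg_right hx (norm_nonneg _)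

/-- Multiplication by an essentially bounded function, on `L²`. -/
def boundedMul (m : α → ℂ) (hm : AEStronglyMeasurable m μ) (C : ℝ)
    (hC : ∀ᵐ x ∂μ, ‖m x‖ ≤ C) : Lp ℂ 2 μ →L[ℂ] Lp ℂ 2 μ :=
  LinearMap.mkContinuous
    { toFun := fun f => (memLp_bounded_mul hm hC (Lp.memLp f)).toLp
      map_add' := by
        intro a b
        rw [← MemLp.toLp_add]
        refine MemLp.toLp_congr _ _ ?_
        filter_upwards [Lp.coeFn_add a b] with p hp
        rw [hp, Pi.add_apply, Pi.add_apply, mul_add]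
      map_smul' := by
        intro c a
        rw [RingHom.id_apply, ← MemLp.toLp_const_smul]
        refine MemLp.toLp_congr _ _ ?_
        filter_upwards [Lp.coeFn_smul c a] with p hp
        rw [hp, Pi.smul_apply, Pi.smul_apply, smul_eq_mul, smul_eq_mul, mul_left_comm] } C <| by
    intro f
    refine Lp.norm_le_mul_norm_of_ae_le_mul ?_
    filter_upwards [(memLp_bounded_mul hm hC (Lp.memLp f)).coeFn_toLp, hC] with x hx hx'
    change ‖(memLp_bounded_mul hm hC (Lp.memLp f)).toLp _ x‖ ≤ _
    rw [hx, norm_mul]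
    exact mul_le_mul_of_nonneg_right hx' (norm_nonneg _)

theorem boundedMul_coeFn {m : α → ℂ} (hm : AEStronglyMeasurable m μ) {C : ℝ}
    (hC : ∀ᵐ x ∂μ, ‖m x‖ ≤ C) (f : Lp ℂ 2 μ) :
    boundedMul m hm C hC f =ᵐ[μ] fun x => m x * f x :=
  (memLp_bounded_mul hm hC (Lp.memLp f)).coeFn_toLp

end Multiplication

/-! ### Multiplication by `iω` and its resolvent -/

section Multiplier

variable {g : FreqDensity}

theorem ae_fst_of_ae {p : ℝ → Prop} (h : ∀ᵐ ω ∂g.measure, p ω) :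
    ∀ᵐ q ∂g.measureX, p q.1 :=
  Measure.quasiMeasurePreserving_fst.ae h

theorem ae_snd_of_ae {p : I → Prop} (h : ∀ᵐ x, p x) : ∀ᵐ q ∂g.measureX, p q.2 :=
  Measure.quasiMeasurePreserving_snd.ae h

theorem mulOp_coeFn (v : (mulOp g).domain) :
    mulOp g v =ᵐ[g.measureX] fun p => Complex.I * (p.1 : ℂ) * (v : L2X g) p :=
  (memLp_of_mem_mulDomain v.2).coeFn_toLp

theorem shift_mulOp_coeFn (z : ℂ) (v : (mulOp g).domain) :
    shift (mulOp g) z v =ᵐ[g.measureX]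
      fun p => (Complex.I * (p.1 : ℂ) - z) * (v : L2X g) p := by
  have h : shift (mulOp g) z v = mulOp g v - z • (v : L2X g) := rfl
  rw [h]
  filter_upwards [Lp.coeFn_sub (mulOp g v) (z • (v : L2X g)), Lp.coeFn_smul z (v : L2X g),
    mulOp_coeFn v] with p h1 h2 h3
  rw [h1, Pi.sub_apply, h2, h3, Pi.smul_apply, smul_eq_mul, sub_mul]

/-- `z` stays at a positive distance from `i ω` for `g`-almost all `ω`. -/
def IsSeparated (g : FreqDensity) (z : ℂ) : Prop :=
  ∃ ε : ℝ, 0 < ε ∧ ∀ᵐ ω : ℝ ∂g.measure, ε ≤ ‖z - Complex.I * (ω : ℂ)‖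

theorem isSeparated_of_re_ne_zero {z : ℂ} (hz : z.re ≠ 0) : IsSeparated g z :=
  ⟨|z.re|, abs_pos.2 hz, Eventually.of_forall (FreqDensity.abs_re_le_norm_sub z)⟩

theorem isSeparated_of_notMem {z : ℂ}
    (hz : z ∉ {z : ℂ | ∃ ω ∈ tsupport g.dens, z = Complex.I * (ω : ℂ)}) : IsSeparated g z := by
  by_cases hre : z.re = 0
  · have hzi : z = Complex.I * (z.im : ℂ) := by
      apply Complex.ext <;> simp [hre]
    have hτ : z.im ∈ (tsupport g.dens)ᶜ := fun h => hz ⟨z.im, h, hzi⟩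
    obtain ⟨ε, hε, hb⟩ := Metric.isOpen_iff.1 (isClosed_tsupport g.dens).isOpen_compl _ hτ
    refine ⟨ε, hε, ?_⟩
    filter_upwards [g.ae_mem_tsupport] with ω hω
    by_contra! hlt
    refine hb ?_ hω
    rw [hzi, ← mul_sub, norm_mul, Complex.norm_I, one_mul, ← Complex.ofReal_sub,
      Complex.norm_real] at hlt
    rwa [Metric.mem_ball, dist_comm, Real.dist_eq]
  · exact isSeparated_of_re_ne_zero hre

/-- The resolvent `(iω - z)⁻¹` of the multiplication operator at a separated point. -/
def mulResolvent {z : ℂ} (hz : IsSeparated g z) : L2X g →L[ℂ] L2X g :=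
  boundedMul (fun p : ℝ × I => (Complex.I * (p.1 : ℂ) - z)⁻¹)
    (by fun_prop) (hz.choose)⁻¹ <| by
      refine ae_fst_of_ae (p := fun ω => ‖(Complex.I * (ω : ℂ) - z)⁻¹‖ ≤ (hz.choose)⁻¹) ?_
      filter_upwards [hz.choose_spec.2] with ω hω
      rw [norm_inv, norm_sub_rev]
      exact inv_anti₀ hz.choose_spec.1 hω

theorem mulResolvent_coeFn {z : ℂ} (hz : IsSeparated g z) (u : L2X g) :
    mulResolvent hz u =ᵐ[g.measureX] fun p => (Complex.I * (p.1 : ℂ) - z)⁻¹ * u p :=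
  boundedMul_coeFn _ _ _

theorem ae_sub_ne_zero (g : FreqDensity) (z : ℂ) :
    ∀ᵐ p ∂g.measureX, Complex.I * (p.1 : ℂ) - z ≠ 0 := by
  refine ae_fst_of_ae (p := fun ω => Complex.I * (ω : ℂ) - z ≠ 0) ?_
  filter_upwards [compl_mem_ae_iff.2 (measure_singleton (μ := g.measure) z.im)] with ω hω h
  refine hω ?_
  have := congrArg Complex.im h
  simp only [Complex.sub_im, Complex.mul_im, Complex.I_re, Complex.ofReal_im, mul_zero,
    Complex.I_im, Complex.ofReal_re, one_mul, zero_add, Complex.zero_im] at this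
  exact sub_eq_zero.1 this

theorem mulResolvent_shift {z : ℂ} (hz : IsSeparated g z) (v : (mulOp g).domain) :
    mulResolvent hz (shift (mulOp g) z v) = v := by
  refine Lp.ext ?_
  filter_upwards [mulResolvent_coeFn hz (shift (mulOp g) z v), shift_mulOp_coeFn z v,
    ae_sub_ne_zero g z] with p h1 h2 h3
  rw [h1, h2, inv_mul_cancel_left₀ h3]

theorem mulResolvent_mem {z : ℂ} (hz : IsSeparated g z) (u : L2X g) :
    mulResolvent hz u ∈ (mulOp g).domain := by
  have h := ((Lp.memLp (mulResolvent hz u)).const_mul z).add (Lp.memLp u)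
  refine h.ae_eq ?_
  filter_upwards [mulResolvent_coeFn hz u, ae_sub_ne_zero g z] with p h1 h2
  simp only [Pi.add_apply]
  rw [h1]
  field_simp
  ring

theorem shift_mulResolvent {z : ℂ} (hz : IsSeparated g z) (u : L2X g) :
    shift (mulOp g) z ⟨mulResolvent hz u, mulResolvent_mem hz u⟩ = u := by
  refine Lp.ext ?_
  filter_upwards [mulResolvent_coeFn hz u, shift_mulOp_coeFn z ⟨_, mulResolvent_mem hz u⟩,
    ae_sub_ne_zero g z] with p h1 h2 h3
  rw [h2, h1, mul_inv_cancel_left₀ h3]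

/-- The adjoint multiplies by the conjugate, and `conj (iω - z) = -(iω + conj z)`. -/
theorem inner_mulResolvent {z z' : ℂ} (hz : IsSeparated g z) (hz' : IsSeparated g z')
    (h : z' = -conj z) (u w : L2X g) :
    ⟪mulResolvent hz u, w⟫_ℂ = -⟪u, mulResolvent hz' w⟫_ℂ := by
  rw [L2.inner_def, L2.inner_def, ← integral_neg]
  refine integral_congr_ae ?_
  filter_upwards [mulResolvent_coeFn hz u, mulResolvent_coeFn hz' w] with p h1 h2
  rw [h1, h2, RCLike.inner_apply, RCLike.inner_apply, h]
  have : conj (Complex.I * (p.1 : ℂ) - z) = -(Complex.I * (p.1 : ℂ) - -conj z) := by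
    simp only [map_sub, map_mul, Complex.conj_I, Complex.conj_ofReal]
    ring
  rw [map_mul, map_inv₀, this, inv_neg]
  ring

end Multiplier

/-! ### Closedness and the Fredholm alternative for `T` -/

section Operators

variable {g : FreqDensity} {W : Graphon} {K : ℝ}

/-- `𝒫` as a continuous linear map. -/
def clmP (g : FreqDensity) (W : Graphon) : L2X g →L[ℂ] L2X g :=
  kernelCLM (fun p q => (W.kernel p.2 q.2 : ℂ)) (W.memLp_X g)

theorem clmP_apply (v : L2X g) : clmP g W v = opP g W v :=
  kernelCLM_apply (W.memLp_X g) v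

theorem clmP_inner_comm (h f : L2X g) : ⟪h, clmP g W f⟫_ℂ = ⟪clmP g W h, f⟫_ℂ := by
  rw [clmP_apply, clmP_apply]
  exact kernelOp_inner_comm _ (fun p q => by simp [W.symm p.2 q.2]) h f

theorem clmP_coeFn (v : L2X g) :
    clmP g W v =ᵐ[g.measureX] fun p => ∫ q, (W.kernel p.2 q.2 : ℂ) * v q ∂g.measureX := by
  rw [clmP_apply]
  exact kernelOp_coeFn (W.memLp_X g) v

/-- `𝒫` on a tensor product acts by averaging the first and applying `𝒲` to the second factor. -/
theorem clmP_tensor {v : L2X g} {a : ℝ → ℂ} {b : I → ℂ}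
    (hv : v =ᵐ[g.measureX] fun p => a p.1 * b p.2) (x : I) :
    ∫ q, (W.kernel x q.2 : ℂ) * v q ∂g.measureX =
      (∫ ω, a ω ∂g.measure) * ∫ y, (W.kernel x y : ℂ) * b y := by
  rw [← integral_prod_mul]
  refine integral_congr_ae ?_
  filter_upwards [hv] with q hq
  rw [hq]
  ring

theorem shift_opT (z : ℂ) (v : (mulOp g).domain) :
    shift (opT g W K) z v = shift (mulOp g) z v + ((K : ℂ) / 2) • clmP g W (v : L2X g) := by
  have h1 : shift (opT g W K) z v =
    mulOp g v + ((K : ℂ) / 2) • opP g W (v : L2X g) - z • (v : L2X g) := rfl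
  have h2 : shift (mulOp g) z v = mulOp g v - z • (v : L2X g) := rfl
  rw [h1, h2, clmP_apply]
  abel

theorem mem_pointSpectrum_iff {z : ℂ} :
    z ∈ pointSpectrum (opT g W K) ↔
      ∃ v : (mulOp g).domain, (v : L2X g) ≠ 0 ∧ shift (opT g W K) z v = 0 := by
  refine exists_congr fun v => and_congr_right fun _ => ?_
  rw [← sub_eq_zero]
  rfl

theorem injective_shift_iff {z : ℂ} :
    Function.Injective (shift (opT g W K) z) ↔ z ∉ pointSpectrum (opT g W K) := by
  rw [mem_pointSpectrum_iff, injective_iff_map_eq_zero]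
  push Not
  exact forall_congr' fun v =>
    ⟨fun h hv h0 => hv (by rw [h h0]; rfl), fun h h0 => by
      by_contra hv
      exact h (fun h' => hv (Subtype.ext h')) h0⟩

/-- The equation `(T - z) v = u` in resolvent form. -/
theorem exists_shift_eq_iff {z : ℂ} (hz : IsSeparated g z) (v u : L2X g) :
    (∃ v' : (mulOp g).domain, (v' : L2X g) = v ∧ shift (opT g W K) z v' = u) ↔
      v = mulResolvent hz (u - ((K : ℂ) / 2) • clmP g W v) := by
  constructor
  · rintro ⟨v', rfl, rfl⟩
    rw [shift_opT, add_sub_cancel_right, mulResolvent_shift]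
  · intro h
    refine ⟨⟨_, mulResolvent_mem hz (u - ((K : ℂ) / 2) • clmP g W v)⟩, h.symm, ?_⟩
    rw [shift_opT, shift_mulResolvent]
    simp only [← h, sub_add_cancel]

/-- In resolvent form at the point `1`, the graph is the solution set of an equation between bounded
operators. -/
theorem isClosed_opT : (opT g W K).IsClosed := by
  have hz : IsSeparated g 1 := isSeparated_of_re_ne_zero (by simp)
  have hs : ((opT g W K).graph : Set (L2X g × L2X g)) =
      {q | q.1 = mulResolvent hz (q.2 - q.1 - ((K : ℂ) / 2) • clmP g W q.1)} := by
    ext ⟨v, u⟩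
    rw [mem_ofPred_eq, ← exists_shift_eq_iff hz, SetLike.mem_coe, LinearPMap.mem_graph_iff]
    refine exists_congr fun v' => and_congr_right fun hv => ?_
    have : shift (opT g W K) 1 v' = opT g W K v' - (1 : ℂ) • (v' : L2X g) := rfl
    simp only at hv ⊢
    rw [this, one_smul, hv, sub_left_inj]
  change _root_.IsClosed ((opT g W K).graph : Set (L2X g × L2X g))
  rw [hs]
  exact isClosed_eq continuous_fst (by fun_prop)

/-- The Fredholm alternative for `T - z` away from the essential spectrum. -/
theorem mem_pointSpectrum_or_mem_resolventSet {z : ℂ} (hz : IsSeparated g z) :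
    z ∈ pointSpectrum (opT g W K) ∨ z ∈ resolventSet (opT g W K) := by
  -- With `R` the multiplication resolvent, `(T - z) v = u` becomes `(1 - A) v = R u`, and `A` is
  -- compact because `𝒫` is.
  let A : L2X g →L[ℂ] L2X g := (-((K : ℂ) / 2)) • ((mulResolvent hz).comp (clmP g W))
  have hA : ∀ v, A v = -(((K : ℂ) / 2) • mulResolvent hz (clmP g W v)) := fun v =>
    neg_smul ((K : ℂ) / 2) (mulResolvent hz (clmP g W v))
  have hAv : ∀ v u, v = mulResolvent hz (u - ((K : ℂ) / 2) • clmP g W v) ↔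
      v - A v = mulResolvent hz u := by
    intro v u
    rw [hA, map_sub, map_smul, sub_neg_eq_add]
    exact eq_sub_iff_add_eq
  have hAc : IsCompactOperator A :=
    ((isCompactOperator_kernelCLM (W.memLp_X g)).clm_comp (mulResolvent hz)).smul (-((K : ℂ) / 2))
  rcases hAc.hasEigenvalue_or_mem_resolventSet one_ne_zero with h | h
  · left
    obtain ⟨v, hv⟩ := h.exists_hasEigenvector
    have h1 : A v = v := by simpa using hv.apply_eq_smul
    obtain ⟨v', hv', h2⟩ := (exists_shift_eq_iff (W := W) (K := K) hz v 0).2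
      ((hAv v 0).2 (by rw [h1, sub_self, map_zero]))
    exact mem_pointSpectrum_iff.2 ⟨v', hv' ▸ hv.2, h2⟩
  · right
    rw [spectrum.mem_resolventSet_iff, map_one] at h
    obtain ⟨R, hR⟩ := h
    have hl : ∀ v, (↑R⁻¹ : L2X g →L[ℂ] L2X g) (v - A v) = v := by
      intro v
      have := congrArg (fun B : L2X g →L[ℂ] L2X g => B v) R.inv_mul
      simpa [hR] using this
    have hr : ∀ v, (↑R⁻¹ : L2X g →L[ℂ] L2X g) v - A ((↑R⁻¹ : L2X g →L[ℂ] L2X g) v) = v := by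
      intro v
      have := congrArg (fun B : L2X g →L[ℂ] L2X g => B v) R.mul_inv
      simpa [hR] using this
    have key : ∀ v : (mulOp g).domain, (v : L2X g) =
        (↑R⁻¹ : L2X g →L[ℂ] L2X g) (mulResolvent hz (shift (opT g W K) z v)) := by
      intro v
      rw [← (hAv v _).1 ((exists_shift_eq_iff hz _ _).1 ⟨v, rfl, rfl⟩), hl]
    refine ⟨⟨?_, ?_⟩, ‖(↑R⁻¹ : L2X g →L[ℂ] L2X g).comp (mulResolvent hz)‖, fun v => ?_⟩
    · intro v w hvw
      exact Subtype.ext (by rw [key v, key w, hvw])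
    · intro u
      obtain ⟨v', -, h'⟩ := (exists_shift_eq_iff (W := W) (K := K) hz
        ((↑R⁻¹ : L2X g →L[ℂ] L2X g) (mulResolvent hz u)) u).2 ((hAv _ _).2 (hr _))
      exact ⟨v', h'⟩
    · calc ‖(v : L2X g)‖ = ‖((↑R⁻¹ : L2X g →L[ℂ] L2X g).comp (mulResolvent hz))
            (shift (opT g W K) z v)‖ := by
            rw [ContinuousLinearMap.comp_apply, ← key v]
        _ ≤ _ := ContinuousLinearMap.le_opNorm _ _

end Operators

/-! ### Real eigenvalues of `𝒲` and their extremes -/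

section Graphon

variable {W : Graphon}

/-- `𝒲` as a continuous linear map. -/
def Graphon.clm (W : Graphon) : Lp ℂ 2 (volume : Measure I) →L[ℂ] Lp ℂ 2 (volume : Measure I) :=
  kernelCLM (fun x y => (W.kernel x y : ℂ)) W.memLp_complex

theorem Graphon.coe_clm (W : Graphon) :
    (W.clm : Module.End ℂ (Lp ℂ 2 (volume : Measure I))) = W.op :=
  LinearMap.ext fun f => kernelCLM_apply W.memLp_complex f

theorem Graphon.op_coeFn (W : Graphon) (f : Lp ℂ 2 (volume : Measure I)) :
    W.op f =ᵐ[volume] fun x => ∫ y, (W.kernel x y : ℂ) * f y :=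
  kernelOp_coeFn W.memLp_complex f

theorem Graphon.conj_eigenvalue {ζ : ℂ} (h : Module.End.HasEigenvalue W.op ζ) :
    conj ζ = ζ := by
  have hs : W.op.IsSymmetric := fun f k =>
    (kernelOp_inner_comm W.memLp_complex (fun x y => by simp [W.symm x y]) f k).symm
  exact hs.conj_eigenvalue_eq_self h

theorem Graphon.hasEigenvalue_op_iff {ζ : ℂ} (h : ζ ≠ 0) :
    Module.End.HasEigenvalue W.op ζ ↔ ζ ∈ spectrum ℂ W.clm := by
  rw [← W.coe_clm]
  exact (isCompactOperator_kernelCLM W.memLp_complex).hasEigenvalue_iff_mem_spectrum h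

theorem Graphon.isCompact_real_spectrum (W : Graphon) :
    IsCompact {x : ℝ | (x : ℂ) ∈ spectrum ℂ W.clm} :=
  Complex.isometry_ofReal.isClosedEmbedding.isCompact_preimage (spectrum.isCompact W.clm)

theorem Graphon.isGreatest_zetaMax (W : Graphon) (h : W.posEigs.Nonempty) :
    IsGreatest W.posEigs W.zetaMax := by
  obtain ⟨ζ, hζ, he⟩ := h
  have hmem : ∀ {x : ℝ}, 0 < x →
      (Module.End.HasEigenvalue W.op (x : ℂ) ↔ (x : ℂ) ∈ spectrum ℂ W.clm) := fun hx =>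
    W.hasEigenvalue_op_iff (by exact_mod_cast hx.ne')
  -- Positive eigenvalues may accumulate at `0`; cutting the spectrum at the known eigenvalue `ζ`
  -- leaves a nonempty compact set of eigenvalues.
  obtain ⟨m, hm⟩ := (W.isCompact_real_spectrum.inter_right isClosed_Ici).exists_isGreatest
    ⟨ζ, (hmem hζ).1 he, mem_Ici.2 le_rfl⟩
  have hm0 : 0 < m := hζ.trans_le hm.1.2
  have hg : IsGreatest W.posEigs m := by
    refine ⟨⟨hm0, (hmem hm0).2 hm.1.1⟩, fun x hx => ?_⟩
    rcases le_total ζ x with h | h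
    · exact hm.2 ⟨(hmem hx.1).1 hx.2, h⟩
    · exact h.trans hm.1.2
  rwa [zetaMax, hg.csSup_eq]

theorem Graphon.isLeast_zetaMin (W : Graphon) (h : W.negEigs.Nonempty) :
    IsLeast W.negEigs W.zetaMin := by
  obtain ⟨ζ, hζ, he⟩ := h
  have hmem : ∀ {x : ℝ}, x < 0 →
      (Module.End.HasEigenvalue W.op (x : ℂ) ↔ (x : ℂ) ∈ spectrum ℂ W.clm) := fun hx =>
    W.hasEigenvalue_op_iff (by exact_mod_cast hx.ne)
  obtain ⟨m, hm⟩ := (W.isCompact_real_spectrum.inter_right isClosed_Iic).exists_isLeast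
    ⟨ζ, (hmem hζ).1 he, mem_Iic.2 le_rfl⟩
  have hm0 : m < 0 := lt_of_le_of_lt hm.1.2 hζ
  have hg : IsLeast W.negEigs m := by
    refine ⟨⟨hm0, (hmem hm0).2 hm.1.1⟩, fun x hx => ?_⟩
    rcases le_total x ζ with h | h
    · exact hm.2 ⟨(hmem hx.1).1 hx.2, h⟩
    · exact le_trans hm.1.2 h
  rwa [zetaMin, hg.csInf_eq]

end Graphon

/-! ### Correspondence between eigenvalues of `T` and `𝒲` -/

section Eigenvalues

variable {g : FreqDensity} {W : Graphon} {K : ℝ}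

theorem memLp_snd_iff {f : I → ℂ} (hf : AEStronglyMeasurable f volume) :
    MemLp (fun p : ℝ × I => f p.2) 2 g.measureX ↔ MemLp f 2 volume := by
  have hs : MeasurePreserving (Prod.snd : ℝ × I → I) g.measureX volume := measurePreserving_snd
  rw [← hs.map_eq] at hf ⊢
  exact (memLp_map_measure_iff hf measurable_snd.aemeasurable).symm

/-- Eigenvalues of `T` come from eigenvalues of `𝒲`. -/
theorem exists_hasEigenvalue_of_mem_pointSpectrum {z : ℂ}
    (hz : z ∈ pointSpectrum (opT g W K)) :
    ∃ ζ, Module.End.HasEigenvalue W.op ζ ∧ (K : ℂ) / 2 * g.transform z * ζ = 1 := by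
  obtain ⟨v, hv0, hv⟩ := mem_pointSpectrum_iff.1 hz
  set f : I → ℂ := fun x => ∫ q, (W.kernel x q.2 : ℂ) * (v : L2X g) q ∂g.measureX with hf
  set D := g.transform z with hD
  have hPv := clmP_coeFn (W := W) (v : L2X g)
  have hve : (v : L2X g) =ᵐ[g.measureX]
      fun p => (z - Complex.I * (p.1 : ℂ))⁻¹ * ((K : ℂ) / 2 * f p.2) := by
    rw [shift_opT] at hv
    have h0 := (Lp.eq_zero_iff_ae_eq_zero.1 hv)
    filter_upwards [h0, Lp.coeFn_add (shift (mulOp g) z v) (((K : ℂ) / 2) • clmP g W (v : L2X g)),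
      shift_mulOp_coeFn z v, Lp.coeFn_smul ((K : ℂ) / 2) (clmP g W (v : L2X g)), hPv,
      ae_sub_ne_zero g z] with p h1 h2 h3 h4 h5 h6
    rw [h2, Pi.add_apply, h3, h4, Pi.smul_apply, h5, smul_eq_mul, Pi.zero_apply] at h1
    have h7 : z - Complex.I * (p.1 : ℂ) ≠ 0 := fun h => h6 (by rw [← neg_sub, h, neg_zero])
    rw [eq_inv_mul_iff_mul_eq₀ h7]
    simp only [hf]
    linear_combination -h1
  -- The product formula for integrals needs no integrability, so this covers imaginary `z` too,
  -- even if `D` is only a default value `0`.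
  have hfe : ∀ x, f x = D * ∫ y, (W.kernel x y : ℂ) * ((K : ℂ) / 2 * f y) := fun x =>
    clmP_tensor hve x
  have hfe' : ∀ x, f x = (K : ℂ) / 2 * D * ∫ y, (W.kernel x y : ℂ) * f y := by
    intro x
    rw [hfe x, mul_comm ((K : ℂ) / 2) D, mul_assoc, ← integral_const_mul ((K : ℂ) / 2)]
    congr 2
    funext y
    ring
  have hfm : AEStronglyMeasurable f volume := by
    refine AEStronglyMeasurable.integral_prod_right'
      (f := fun r : I × (ℝ × I) => (W.kernel r.1 r.2.2 : ℂ) * (v : L2X g) r.2) ?_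
    refine AEStronglyMeasurable.mul ?_ (Lp.aestronglyMeasurable _).comp_snd
    have hs : MeasurePreserving (Prod.snd : ℝ × I → I) g.measureX volume := measurePreserving_snd
    exact W.memLp_complex.1.comp_measurePreserving ((MeasurePreserving.id volume).prod hs)
  have hfL : MemLp f 2 volume :=
    (memLp_snd_iff (g := g) hfm).1 ((Lp.memLp (clmP g W (v : L2X g))).ae_eq hPv)
  set F := hfL.toLp with hF
  have hFf : F =ᵐ[volume] f := hfL.coeFn_toLp
  have hF0 : F ≠ 0 := by
    intro h
    refine hv0 (Lp.eq_zero_iff_ae_eq_zero.2 ?_)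
    rw [Lp.eq_zero_iff_ae_eq_zero] at h
    have h0 : ∀ᵐ x, f x = 0 := by
      filter_upwards [h, hFf] with x h1 h2
      rw [← h2, h1, Pi.zero_apply]
    filter_upwards [hve, ae_snd_of_ae h0] with p h1 h2
    rw [h1, h2]
    simp
  have hFW : F = ((K : ℂ) / 2 * D) • W.op F := by
    refine Lp.ext ?_
    filter_upwards [Lp.coeFn_smul ((K : ℂ) / 2 * D) (W.op F), W.op_coeFn F, hFf] with x h1 h2 h3
    rw [h1, Pi.smul_apply, h2, h3, smul_eq_mul, hfe' x]
    congr 1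
    refine integral_congr_ae ?_
    filter_upwards [hFf] with y hy
    rw [hy]
  have hc : (K : ℂ) / 2 * D ≠ 0 := by
    intro h
    rw [h, zero_smul] at hFW
    exact hF0 hFW
  refine ⟨((K : ℂ) / 2 * D)⁻¹, ?_, mul_inv_cancel₀ hc⟩
  refine Module.End.hasEigenvalue_of_hasEigenvector (x := F)
    ⟨Module.End.mem_eigenspace_iff.2 ?_, hF0⟩
  nth_rw 2 [hFW]
  rw [inv_smul_smul₀ hc]

theorem mem_pointSpectrum_of_hasEigenvalue {z : ℂ} (hz : z.re ≠ 0) {ζ : ℂ}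
    (hζ : Module.End.HasEigenvalue W.op ζ) (h : (K : ℂ) / 2 * g.transform z * ζ = 1) :
    z ∈ pointSpectrum (opT g W K) := by
  obtain ⟨F, hF⟩ := hζ.exists_hasEigenvector
  have hs := isSeparated_of_re_ne_zero (g := g) hz
  have hL : MemLp (fun p : ℝ × I => -F p.2) 2 g.measureX :=
    (memLp_snd_iff (g := g) (f := fun x => -F x) (Lp.aestronglyMeasurable F).neg).2
      (Lp.memLp F).neg
  -- The sign turns the resolvent factor `(iω - z)⁻¹` into `(z - iω)⁻¹`, so the candidate
  -- eigenvector is `F(x) / (z - iω)`.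
  set u : L2X g := hL.toLp with hu
  have huF : u =ᵐ[g.measureX] fun p => -F p.2 := hL.coeFn_toLp
  have hv : mulResolvent hs u =ᵐ[g.measureX]
      fun p => (z - Complex.I * (p.1 : ℂ))⁻¹ * F p.2 := by
    filter_upwards [mulResolvent_coeFn hs u, huF] with p h1 h2
    rw [h1, h2, ← neg_sub z, inv_neg]
    ring
  have hu0 : u ≠ 0 := by
    intro h0
    refine hF.2 (Lp.eq_zero_iff_ae_eq_zero.2 ?_)
    have hsn : MeasurePreserving (Prod.snd : ℝ × I → I) g.measureX volume :=
      measurePreserving_snd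
    have h1 : ∀ᵐ p ∂g.measureX, F p.2 = 0 := by
      filter_upwards [huF, Lp.eq_zero_iff_ae_eq_zero.1 h0] with p h1 h2
      rw [h2] at h1
      simpa using h1.symm
    have h2 : ∀ᵐ x ∂(Measure.map Prod.snd g.measureX), F x = 0 := by
      exact (ae_map_iff hsn.measurable.aemeasurable
        ((Lp.stronglyMeasurable F).measurable (measurableSet_singleton 0))).2 h1
    rwa [hsn.map_eq] at h2
  refine mem_pointSpectrum_iff.2 ⟨⟨_, mulResolvent_mem hs u⟩, fun h0 => hu0 ?_, ?_⟩
  · have h1 : (⟨_, mulResolvent_mem hs u⟩ : (mulOp g).domain) = 0 := Subtype.ext h0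
    rw [← shift_mulResolvent hs u, h1, map_zero]
  · rw [shift_opT, shift_mulResolvent]
    refine Lp.eq_zero_iff_ae_eq_zero.2 ?_
    have hWF : ∀ᵐ x, ∫ y, (W.kernel x y : ℂ) * F y = ζ * F x := by
      have h1 : W.op F = ζ • F := hF.apply_eq_smul
      filter_upwards [W.op_coeFn F, Lp.coeFn_smul ζ F] with x h2 h3
      rw [← h2, h1, h3, Pi.smul_apply, smul_eq_mul]
    filter_upwards [Lp.coeFn_add u (((K : ℂ) / 2) • clmP g W (mulResolvent hs u)),
      Lp.coeFn_smul ((K : ℂ) / 2) (clmP g W (mulResolvent hs u)),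
      clmP_coeFn (W := W) (mulResolvent hs u), huF, ae_snd_of_ae hWF] with p h1 h2 h3 h4 h5
    rw [h1, Pi.add_apply, h2, Pi.smul_apply, h3, h4,
      clmP_tensor (a := fun ω => (z - Complex.I * (ω : ℂ))⁻¹) (b := F) hv, h5, smul_eq_mul,
      Pi.zero_apply]
    change -F p.2 + (K : ℂ) / 2 * (g.transform z * (ζ * F p.2)) = 0
    linear_combination F p.2 * h

/-- Every eigenvalue of `T` is real and nonzero, and is tied to a real eigenvalue of `𝒲`. -/
theorem exists_real_of_mem_pointSpectrum {z : ℂ} (hz : z ∈ pointSpectrum (opT g W K)) :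
    ∃ x : ℝ, x ≠ 0 ∧ z = x ∧ ∃ ζ : ℝ, Module.End.HasEigenvalue W.op (ζ : ℂ) ∧
      (K : ℂ) / 2 * g.transform z * ζ = 1 := by
  obtain ⟨ζ, hζ, h⟩ := exists_hasEigenvalue_of_mem_pointSpectrum hz
  obtain ⟨ξ, rfl⟩ := Complex.conj_eq_iff_real.1 (Graphon.conj_eigenvalue hζ)
  have hre := congrArg Complex.re h
  have him := congrArg Complex.im h
  have e : (K : ℂ) / 2 * g.transform z * ξ = ((K / 2 * ξ : ℝ) : ℂ) * g.transform z := by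
    push_cast; ring
  rw [e, Complex.re_ofReal_mul, Complex.one_re] at hre
  rw [e, Complex.im_ofReal_mul, Complex.one_im] at him
  have hc : K / 2 * ξ ≠ 0 := fun h0 => by rw [h0, zero_mul] at hre; exact zero_ne_one hre
  have hzr : z.re ≠ 0 := fun h0 => by
    rw [g.transform_re_of_re_eq_zero h0, mul_zero] at hre
    exact zero_ne_one hre
  have hzi : z.im = 0 :=
    g.im_eq_zero_of_transform_im_eq_zero hzr ((mul_eq_zero.1 him).resolve_left hc)
  exact ⟨z.re, hzr, Complex.ext (by simp) (by simp [hzi]), ξ, hζ, h⟩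

theorem notMem_pointSpectrum_of_re_eq_zero {z : ℂ} (hz : z.re = 0) :
    z ∉ pointSpectrum (opT g W K) := by
  intro h
  obtain ⟨x, hx, rfl, -⟩ := exists_real_of_mem_pointSpectrum h
  exact hx (by simpa using hz)

end Eigenvalues

/-! ### Dense range and lack of a resolvent bound on the imaginary axis -/

section ImaginaryAxis

variable {g : FreqDensity} {W : Graphon} {K : ℝ}

/-- On the imaginary axis `T - z` always has dense range. -/
theorem denseRange_shift_of_re_eq_zero {z : ℂ} (hz : z.re = 0) :
    DenseRange (shift (opT g W K) z) := by
  have h1 : IsSeparated g 1 := isSeparated_of_re_ne_zero (by simp)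
  have h1' : IsSeparated g (-1) := isSeparated_of_re_ne_zero (by simp)
  have hconj : conj z = -z := by
    apply Complex.ext <;> simp [hz]
  suffices h : (LinearMap.range (shift (opT g W K) z)).topologicalClosure = ⊤ by
    rw [← Submodule.dense_iff_topologicalClosure_eq_top] at h
    exact h
  rw [Submodule.topologicalClosure_eq_top_iff, Submodule.eq_bot_iff]
  intro w hw
  have hk : ((K : ℂ) / 2) = conj ((K : ℂ) / 2) := by
    simpa using (Complex.conj_ofReal (K / 2)).symm
  -- Formally the adjoint equation reads `(iω - (K/2)𝒫 - z) w = 0`. Testing only against `v = R₁ u`,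
  -- with `R₁` the multiplication resolvent at `1`, yields it in resolvent form at `-1`; this also
  -- puts `w` in the domain without computing an unbounded adjoint.
  have horth : w - mulResolvent h1' ((1 + z) • w + ((K : ℂ) / 2) • clmP g W w) = 0 := by
    refine ext_inner_left ℂ fun u => ?_
    set v : (mulOp g).domain := ⟨mulResolvent h1 u, mulResolvent_mem h1 u⟩ with hv
    have h2 := (Submodule.mem_orthogonal _ w).1 hw _ ⟨v, rfl⟩
    have h3 : shift (mulOp g) z v = u + (1 - z) • mulResolvent h1 u := by
      have e : shift (mulOp g) z v = shift (mulOp g) 1 v + (1 - z) • (v : L2X g) := by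
        change mulOp g v - z • (v : L2X g) =
          mulOp g v - (1 : ℂ) • (v : L2X g) + (1 - z) • (v : L2X g)
        module
      rw [e, hv, shift_mulResolvent]
    rw [shift_opT, h3] at h2
    simp only [inner_add_left, inner_smul_left, ← clmP_inner_comm, hv,
      inner_mulResolvent h1 h1' (by simp : (-1 : ℂ) = -conj 1)] at h2
    rw [inner_sub_right, map_add, map_smul, map_smul, inner_add_right, inner_smul_right,
      inner_smul_right, inner_zero_right]
    rw [← hk, map_sub, map_one, hconj] at h2
    linear_combination h2
  rw [sub_eq_zero] at horth
  by_contra hw0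
  refine notMem_pointSpectrum_of_re_eq_zero (g := g) (W := W) (K := -K) hz
    (mem_pointSpectrum_iff.2 ?_)
  obtain ⟨w', hw', he⟩ := (exists_shift_eq_iff (W := W) (K := -K) h1' w ((1 + z) • w)).2 (by
    nth_rw 1 [horth]
    congr 1
    push_cast
    module)
  refine ⟨w', hw' ▸ hw0, ?_⟩
  have e : shift (opT g W (-K)) z w' = shift (opT g W (-K)) (-1) w' - (1 + z) • (w' : L2X g) := by
    change opT g W (-K) w' - z • (w' : L2X g) =
      opT g W (-K) w' - (-1 : ℂ) • (w' : L2X g) - (1 + z) • (w' : L2X g)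
    module
  rw [e, he, hw', sub_self]

/-- Approximate eigenvectors: let `v` be the indicator of `B × I` for a small neighbourhood `B` of
`τ`. Multiplication by `iω - iτ` shrinks it by `δ`, while `𝒫 v = ‖v‖² 𝒫 1` is quadratically small. A
resolvent bound would then give `1 ≤ C'(δ + ‖v‖ c)`. -/
theorem mul_tsupport_notMem_resolventSet {τ : ℝ} (hτ : τ ∈ tsupport g.dens) :
    Complex.I * (τ : ℂ) ∉ resolventSet (opT g W K) := by
  rintro ⟨-, C, hC⟩
  let e : L2X g := indicatorConstLp 2 (MeasurableSet.univ (α := ℝ × I))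
    (measure_ne_top g.measureX _) (1 : ℂ)
  set c := ‖((K : ℂ) / 2) • clmP g W e‖ with hc
  set C' := max C 1 with hC'
  have hC0 : 0 < C' := lt_max_of_lt_right one_pos
  have hc0 : 0 ≤ c := norm_nonneg _
  -- Chosen so that `C' δ (c + 1) = 1/4 < 1`, once `‖v‖ ≤ δ`.
  set δ : ℝ := 1 / (4 * C' * (c + 1)) with hδ
  have hδ0 : 0 < δ := by positivity
  -- The point `τ` is null, so outer regularity gives a neighbourhood of mass below `δ²`; since
  -- `‖v‖²` is the mass of `B`, this yields `‖v‖ ≤ δ`.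
  obtain ⟨V, hτV, hVo, hV⟩ := Set.exists_isOpen_lt_of_lt (μ := g.measure) {τ}
    (ENNReal.ofReal (δ ^ 2)) (by rw [measure_singleton]; simpa using pow_pos hδ0 2)
  set B := V ∩ Metric.ball τ δ with hB
  have hBo : IsOpen B := hVo.inter Metric.isOpen_ball
  have hm0 : 0 < g.measure B := g.measure_pos_of_mem_tsupport hτ hBo
    ⟨hτV rfl, Metric.mem_ball_self hδ0⟩
  have hBm : MeasurableSet (B ×ˢ (univ : Set I)) := hBo.measurableSet.prod .univ
  let v : L2X g := indicatorConstLp 2 hBm (measure_ne_top g.measureX _) (1 : ℂ)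
  have hvB : v =ᵐ[g.measureX] fun p => B.indicator (fun _ => (1 : ℂ)) p.1 * 1 := by
    filter_upwards [indicatorConstLp_coeFn (p := 2) (hs := hBm)
      (hμs := measure_ne_top g.measureX _) (c := (1 : ℂ))] with p hp
    rw [hp]
    by_cases h : p.1 ∈ B <;> simp [h]
  have hvn : ‖v‖ ^ 2 = g.measure.real B := by
    rw [norm_sq_eq_integral]
    have : ∫ x, ‖v x‖ ^ 2 ∂g.measureX =
        ∫ x, (B ×ˢ (univ : Set I)).indicator (fun _ => (1 : ℝ)) x ∂g.measureX := by
      refine integral_congr_ae ?_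
      filter_upwards [hvB] with p hp
      rw [hp]
      by_cases h : p.1 ∈ B <;> simp [h]
    rw [this, integral_indicator_const _ hBm]
    simp [measureReal_prod_prod]
  have hm0' : 0 < g.measure.real B := ENNReal.toReal_pos hm0.ne' (measure_ne_top _ _)
  have hmδ : g.measure.real B ≤ δ ^ 2 :=
    ENNReal.toReal_le_of_le_ofReal (sq_nonneg δ) ((measure_mono inter_subset_left).trans hV.le)
  have hv0 : 0 < ‖v‖ := by
    refine (norm_nonneg v).lt_of_ne fun h => ?_
    rw [← h] at hvn
    simp [← hvn] at hm0'
  have hvδ : ‖v‖ ≤ δ := by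
    rw [← hvn] at hmδ
    exact (sq_le_sq₀ hv0.le hδ0.le).1 hmδ
  have hvd : v ∈ (mulOp g).domain := by
    have hb : MemLp (fun p : ℝ × I => (Complex.I * (p.1 : ℂ)) *
        B.indicator (fun _ => (1 : ℂ)) p.1) 2 g.measureX := by
      refine MemLp.of_bound ?_ (|τ| + δ) (Eventually.of_forall fun p => ?_)
      · refine AEStronglyMeasurable.mul (by fun_prop) ?_
        exact ((stronglyMeasurable_const.indicator hBo.measurableSet).comp_measurable
          measurable_fst).aestronglyMeasurable
      · by_cases h : p.1 ∈ B
        · have h2 : |p.1 - τ| < δ := by simpa [Real.dist_eq] using h.2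
          have h3 : |p.1| ≤ |τ| + δ := by
            have := abs_add_le τ (p.1 - τ)
            rw [add_sub_cancel] at this
            linarith
          simpa [h] using h3
        · simp only [h, not_false_eq_true, indicator_of_notMem, mul_zero, norm_zero]
          positivity
    refine hb.ae_eq ?_
    filter_upwards [hvB] with p hp
    rw [hp, mul_one]
  have hP : clmP g W v = ((g.measure.real B : ℝ) : ℂ) • clmP g W e := by
    have heB : e =ᵐ[g.measureX] fun p => (fun _ : ℝ => (1 : ℂ)) p.1 * 1 := by
      filter_upwards [indicatorConstLp_coeFn (p := 2) (hs := MeasurableSet.univ (α := ℝ × I))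
        (hμs := measure_ne_top g.measureX _) (c := (1 : ℂ))] with p hp
      rw [hp]
      simp
    refine Lp.ext ?_
    filter_upwards [clmP_coeFn (W := W) v, clmP_coeFn (W := W) e,
      Lp.coeFn_smul ((g.measure.real B : ℝ) : ℂ) (clmP g W e)] with p h1 h2 h3
    rw [h3, Pi.smul_apply, h1, h2, clmP_tensor (a := B.indicator fun _ => 1) (b := fun _ => 1) hvB,
      clmP_tensor (a := fun _ => 1) (b := fun _ => 1) heB,
      integral_indicator_const _ hBo.measurableSet]
    simp
  have hS : ‖shift (mulOp g) (Complex.I * (τ : ℂ)) ⟨v, hvd⟩‖ ≤ δ * ‖v‖ := by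
    refine Lp.norm_le_mul_norm_of_ae_le_mul ?_
    filter_upwards [shift_mulOp_coeFn (Complex.I * (τ : ℂ)) ⟨v, hvd⟩, hvB] with p h1 h2
    rw [h1, norm_mul]
    simp only [h2]
    by_cases h : p.1 ∈ B
    · refine mul_le_mul_of_nonneg_right ?_ (norm_nonneg _)
      rw [← mul_sub, norm_mul, Complex.norm_I, one_mul, ← Complex.ofReal_sub, Complex.norm_real]
      exact (mem_ball_iff_norm.1 h.2).le
    · simp [h]
  have hfin : ‖v‖ ≤ C' * (δ * ‖v‖ + ‖v‖ * ‖v‖ * c) := by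
    refine (hC ⟨v, hvd⟩).trans ?_
    refine mul_le_mul (le_max_left _ _) ?_ (norm_nonneg _) hC0.le
    refine (congrArg norm (shift_opT _ ⟨v, hvd⟩)).trans_le ?_
    refine (norm_add_le _ _).trans (add_le_add hS (le_of_eq ?_))
    change ‖((K : ℂ) / 2) • clmP g W v‖ = _
    rw [hP, smul_comm, norm_smul, Complex.norm_real, Real.norm_of_nonneg hm0'.le, ← hvn, sq]
  have h5 : 1 ≤ C' * (δ + ‖v‖ * c) := by
    refine le_of_mul_le_mul_right ?_ hv0
    linarith
  have h6 : C' * (δ + ‖v‖ * c) ≤ C' * (δ * (c + 1)) := by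
    refine mul_le_mul_of_nonneg_left ?_ hC0.le
    nlinarith
  have h7 : C' * (δ * (c + 1)) = 1 / 4 := by
    rw [hδ]
    field_simp
  linarith

end ImaginaryAxis

/-! ### Assembling the spectra -/

section Spectra

variable {g : FreqDensity} {W : Graphon} {K : ℝ}

theorem denseRange_of_mem_resolventSet {z : ℂ} (hz : z ∈ resolventSet (opT g W K)) :
    DenseRange (shift (opT g W K) z) :=
  hz.1.2.denseRange

theorem residualSpectrum_opT : residualSpectrum (opT g W K) = ∅ := by
  refine eq_empty_of_forall_notMem fun z hz => hz.2 ?_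
  by_cases hre : z.re = 0
  · exact denseRange_shift_of_re_eq_zero hre
  · exact denseRange_of_mem_resolventSet
      ((mem_pointSpectrum_or_mem_resolventSet (isSeparated_of_re_ne_zero hre)).resolve_left
        (injective_shift_iff.1 hz.1))

theorem continuousSpectrum_opT : continuousSpectrum (opT g W K) =
    {z : ℂ | ∃ ω ∈ tsupport g.dens, z = Complex.I * (ω : ℂ)} := by
  ext z
  constructor
  · rintro ⟨h1, h2, -⟩
    by_contra h
    exact h1 ((mem_pointSpectrum_or_mem_resolventSet (isSeparated_of_notMem h)).resolve_left
      (injective_shift_iff.1 h2))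
  · rintro ⟨τ, hτ, rfl⟩
    have hre : (Complex.I * (τ : ℂ)).re = 0 := by simp
    exact ⟨mul_tsupport_notMem_resolventSet hτ,
      injective_shift_iff.2 (notMem_pointSpectrum_of_re_eq_zero hre),
      denseRange_shift_of_re_eq_zero hre⟩

theorem fullSpectrum_opT : fullSpectrum (opT g W K) =
    continuousSpectrum (opT g W K) ∪ pointSpectrum (opT g W K) := by
  refine Subset.antisymm (fun z hz => ?_) (union_subset (fun z hz => hz.1) fun z hz h => ?_)
  · by_cases h : z ∈ {z : ℂ | ∃ ω ∈ tsupport g.dens, z = Complex.I * (ω : ℂ)}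
    · exact Or.inl (continuousSpectrum_opT ▸ h)
    · exact Or.inr ((mem_pointSpectrum_or_mem_resolventSet
        (isSeparated_of_notMem h)).resolve_right hz)
  · exact injective_shift_iff.1 h.1.1 hz

end Spectra

/-! ### Transition points and the sign of the eigenvalues -/

section Threshold

variable {g : FreqDensity} {W : Graphon} {K : ℝ}

theorem mul_zetaMax_le (hW : W.posEigs.Nonempty) :
    (K : EReal) ≤ KcPlus g W ↔ K * W.zetaMax ≤ 2 / (Real.pi * g.dens 0) := by
  have h0 := (W.isGreatest_zetaMax hW).1.1
  rw [KcPlus, if_pos hW, EReal.coe_le_coe_iff, ← div_div, le_div_iff₀ h0]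

/-- Multiplying by the negative `ζ_min` reverses the inequality, so both transition points lead to
one condition, `Kζ ≤ 2/(π g(0))`. -/
theorem mul_zetaMin_le (hW : W.negEigs.Nonempty) :
    KcMinus g W ≤ (K : EReal) ↔ K * W.zetaMin ≤ 2 / (Real.pi * g.dens 0) := by
  have h0 := (W.isLeast_zetaMin hW).1.1
  rw [KcMinus, if_pos hW, EReal.coe_le_coe_iff, ← div_div, div_le_iff_of_neg h0]

/-- An eigenvalue `x > 0` would give `Kζ · profile x = 2`, hence `Kζ > 2/(π g(0))`. But `K` and `ζ`
share a sign, so `Kζ` is at most `K ζ_max` or `K ζ_min`, which the hypotheses bound. -/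
theorem eigenvalue_neg_of_subcritical
    (h : KcMinus g W ≤ (K : EReal) ∧ (K : EReal) ≤ KcPlus g W) {z : ℂ}
    (hz : z ∈ pointSpectrum (opT g W K)) : ∃ x : ℝ, x < 0 ∧ z = (x : ℂ) := by
  obtain ⟨x, hx, rfl, ζ, hζ, he⟩ := exists_real_of_mem_pointSpectrum hz
  refine ⟨x, hx.lt_or_gt.resolve_right fun hx0 => ?_, rfl⟩
  rw [g.transform_ofReal hx0] at he
  have he' : K * ζ * g.profile x = 2 := by
    have : K / 2 * g.profile x * ζ = 1 := by exact_mod_cast he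
    linarith
  have hpos : 0 < K * ζ := by
    by_contra! hn
    have := mul_nonpos_of_nonpos_of_nonneg hn (g.profile_nonneg x)
    linarith
  have hle : K * ζ ≤ 2 / (Real.pi * g.dens 0) := by
    rcases pos_and_pos_or_neg_and_neg_of_mul_pos hpos with ⟨hK, h0⟩ | ⟨hK, h0⟩
    · have hW : W.posEigs.Nonempty := ⟨ζ, h0, hζ⟩
      exact (mul_le_mul_of_nonneg_left ((W.isGreatest_zetaMax hW).2 ⟨h0, hζ⟩) hK.le).trans
        ((mul_zetaMax_le hW).1 h.2)
    · have hW : W.negEigs.Nonempty := ⟨ζ, h0, hζ⟩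
      exact (mul_le_mul_of_nonpos_left ((W.isLeast_zetaMin hW).2 ⟨h0, hζ⟩) hK.le).trans
        ((mul_zetaMin_le hW).1 h.1)
  have hg : 0 < Real.pi * g.dens 0 := mul_pos Real.pi_pos g.dens_zero_pos
  have := mul_lt_mul_of_pos_left (g.profile_lt hx0) hpos
  rw [le_div_iff₀ hg] at hle
  linarith

theorem exists_pos_eigenvalue {ζ : ℝ} (hζ : Module.End.HasEigenvalue W.op (ζ : ℂ))
    (h : 2 / (Real.pi * g.dens 0) < K * ζ) :
    ∃ x : ℝ, 0 < x ∧ (x : ℂ) ∈ pointSpectrum (opT g W K) := by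
  have hg : 0 < Real.pi * g.dens 0 := mul_pos Real.pi_pos g.dens_zero_pos
  have hpos : 0 < K * ζ := lt_trans (by positivity) h
  obtain ⟨x, hx, hp⟩ := g.exists_profile_eq (c := 2 / (K * ζ)) (by positivity) (by
    rw [div_lt_iff₀ hpos]
    rw [div_lt_iff₀ hg] at h
    linarith)
  refine ⟨x, hx, mem_pointSpectrum_of_hasEigenvalue (by simpa using hx.ne') hζ ?_⟩
  rw [g.transform_ofReal hx, hp]
  have : K / 2 * (2 / (K * ζ)) * ζ = 1 := by
    have h1 : K ≠ 0 := left_ne_zero_of_mul hpos.ne'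
    have h2 : ζ ≠ 0 := right_ne_zero_of_mul hpos.ne'
    field_simp
  exact_mod_cast this

theorem exists_pos_eigenvalue_of_supercritical
    (h : ¬ (KcMinus g W ≤ (K : EReal) ∧ (K : EReal) ≤ KcPlus g W)) :
    ∃ x : ℝ, 0 < x ∧ (x : ℂ) ∈ pointSpectrum (opT g W K) := by
  -- A bound can only fail when it is finite, so an extreme eigenvalue of the corresponding sign is
  -- available.
  rcases not_and_or.1 h with h | h
  · by_cases hW : W.negEigs.Nonempty
    · rw [mul_zetaMin_le hW, not_le] at h
      exact exists_pos_eigenvalue (W.isLeast_zetaMin hW).1.2 h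
    · simp [KcMinus, hW] at h
  · by_cases hW : W.posEigs.Nonempty
    · rw [mul_zetaMax_le hW, not_le] at h
      exact exists_pos_eigenvalue (W.isGreatest_zetaMax hW).1.2 h
    · simp [KcPlus, hW] at h

end Threshold

end KMGraph

end

open KMGraph
theorem theorem3p1 (g : FreqDensity) (W : Graphon) :
    (W.posEigs.Nonempty → IsGreatest W.posEigs W.zetaMax) ∧
    (W.negEigs.Nonempty → IsLeast W.negEigs W.zetaMin) ∧
    ∀ K : ℝ,
      (opT g W K).IsClosed ∧
      residualSpectrum (opT g W K) = ∅ ∧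
      continuousSpectrum (opT g W K) =
        {z : ℂ | ∃ ω ∈ tsupport g.dens, z = Complex.I * (ω : ℂ)} ∧
      ((KcMinus g W ≤ (K : EReal) ∧ (K : EReal) ≤ KcPlus g W) →
        fullSpectrum (opT g W K) =
          continuousSpectrum (opT g W K) ∪ pointSpectrum (opT g W K) ∧
        ∀ z ∈ pointSpectrum (opT g W K), ∃ x : ℝ, x < 0 ∧ z = (x : ℂ)) ∧
      (¬ (KcMinus g W ≤ (K : EReal) ∧ (K : EReal) ≤ KcPlus g W) →
        ∃ x : ℝ, 0 < x ∧ (x : ℂ) ∈ pointSpectrum (opT g W K)) :=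
  ⟨W.isGreatest_zetaMax, W.isLeast_zetaMin, fun _ =>
    ⟨isClosed_opT, residualSpectrum_opT, continuousSpectrum_opT,
      fun h => ⟨fullSpectrum_opT, fun _ hz => eigenvalue_neg_of_subcritical h hz⟩,
      exists_pos_eigenvalue_of_supercritical⟩⟩
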